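/- Let $V$ be a finite set of cardinality $N\ge 1$ and let $(Y_k)_{k\in V}$ be real random variables on a common probability space. Let $G$ be a multigraph on $V$ (loops and multiple edges allowed) that is a dependency graph of $(Y_k)_{k\in V}$: whenever $V_1,V_2\subset V$ are disjoint and no edge of $G$ has one endpoint in $V_1$ and the other in $V_2$, the families $(Y_k)_{k\in V_1}$ and $(Y_k)_{k\in V_2}$ are independent. Let $D\in\mathbb Z_{\ge 0}$ be the maximal degree of $G$, where the degree of a vertex is the number of edges it belongs to, counted with multiplicity. Let $(c_k)_{k\in V}$ be arbitrary real numbers, let $\delta\in(2,3)$, and put $$\mathcal A_\delta=\sum_{k\in V}\mathbb E\big[|Y_k-c_k|^\delta\big].$$ Assume $\mathcal A_\delta<\infty$. With $S=\sum_{k\in V}Y_k$ and $v=\sqrt{\operatorname{Var}(S)}$, assume $v>0$, and put $$W=\frac{S-\mathbb E[S]}{v},\qquad \xi_\delta=\Big(\frac{N}{\mathcal A_\delta}\Big)^{1/\delta}\sqrt{\frac{\operatorname{Var}(S)}{N(D+1)}}.$$ Then $$d_{\mathrm{Kol}}\big(W,\mathcal N(0,1)\big)\;\le\; 8.015\;\xi_\delta^{-\frac{\delta}{\delta+1}}\Big(\frac{D+1}{N}\Big)^{\frac{\delta-2}{2(\delta+1)}},$$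 where $d_{\mathrm{Kol}}(X,Z)=\sup_{t\in\mathbb R}|\mathbb P(X\le t)-\mathbb P(Z\le t)|$ is the Kolmogorov distance. -/

import Mathlib

open MeasureTheory ProbabilityTheory
open scoped ENNReal

noncomputable section

namespace DependencyGraphCLT

/-! A multigraph on a vertex set `V`, loops and multiple edges being allowed, is given by its
multiset of edges `E : Multiset (Sym2 V)`. -/

open scoped Classical in
/-- The degree of a vertex: the number of edges (with multiplicity) it belongs to. -/
def degree {V : Type*} (E : Multiset (Sym2 V)) (k : V) : ℕ :=
  E.countP (fun e => k ∈ e)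

/-- The maximal degree of a multigraph on a finite vertex set. -/
def maxDegree {V : Type*} [Fintype V] (E : Multiset (Sym2 V)) : ℕ :=
  Finset.univ.sup (degree E)

/-- The multigraph with edges `E` is a dependency graph of the family `Y`: whenever `V₁` and `V₂`
are disjoint sets of vertices with no edge between them, the families `(Y k)_{k ∈ V₁}` and
`(Y k)_{k ∈ V₂}` are independent. -/
def IsDependencyGraph {V Ω : Type*} [MeasurableSpace Ω]
    (E : Multiset (Sym2 V)) (Y : V → Ω → ℝ) (P : Measure Ω) : Prop :=
  ∀ V₁ V₂ : Finset V, Disjoint V₁ V₂ → (∀ i ∈ V₁, ∀ j ∈ V₂, s(i, j) ∉ E) →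
    IndepFun (fun ω (i : V₁) => Y i ω) (fun ω (j : V₂) => Y j ω) P

/-- The sum `S = ∑ k, Y k`. -/
def sumRV {V Ω : Type*} [Fintype V] (Y : V → Ω → ℝ) (ω : Ω) : ℝ :=
  ∑ k, Y k ω

/-- The standard deviation `v = √(Var S)`. -/
def stdDev {V Ω : Type*} [Fintype V] [MeasurableSpace Ω] (Y : V → Ω → ℝ) (P : Measure Ω) : ℝ :=
  √(variance (sumRV Y) P)

/-- The normalized sum `W = (S - 𝔼 S) / √(Var S)`. -/
def normalizedSum {V Ω : Type*} [Fintype V] [MeasurableSpace Ω]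
    (Y : V → Ω → ℝ) (P : Measure Ω) (ω : Ω) : ℝ :=
  (sumRV Y ω - ∫ ω', sumRV Y ω' ∂P) / √(variance (sumRV Y) P)

/-- `A_δ = ∑ k, 𝔼 |Y k - c k| ^ δ`, as an extended non-negative number. -/
def absMoment {V Ω : Type*} [Fintype V] [MeasurableSpace Ω]
    (Y : V → Ω → ℝ) (c : V → ℝ) (δ : ℝ) (P : Measure Ω) : ℝ≥0∞ :=
  ∑ k, ∫⁻ ω, ENNReal.ofReal (|Y k ω - c k| ^ δ) ∂P

/-- The renormalized standard deviation `ξ_δ = (N / A_δ) ^ (1 / δ) * √(Var S / (N (D + 1)))`,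
where `N` is the number of variables. -/
def renormStdDev {V Ω : Type*} [Fintype V] [MeasurableSpace Ω]
    (Y : V → Ω → ℝ) (c : V → ℝ) (D : ℕ) (δ : ℝ) (P : Measure Ω) : ℝ :=
  ((Fintype.card V : ℝ) / (absMoment Y c δ P).toReal) ^ (1 / δ) *
    √(variance (sumRV Y) P / ((Fintype.card V : ℝ) * ((D : ℝ) + 1)))

/-- The Kolmogorov distance of two probability measures on the real line. -/
def kolmogorovDist (μ ν : Measure ℝ) : ℝ :=
  ⨆ t : ℝ, |μ.real (Set.Iic t) - ν.real (Set.Iic t)|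

end DependencyGraphCLT

end

/-!
The proof is Stein's method with smoothed indicator functions. Put
`ξ k = (Y k - 𝔼 Y k) / v`, so that `W = ∑ k, ξ k`, and let `m = D + 1`, which bounds the size of
every closed neighbourhood. The right-hand side of the theorem equals `8.015 * x`, where
`x ^ (δ + 1) = m ^ (δ - 1) * A_δ / v ^ δ` is a Lyapunov ratio (`renormStdDev_rpow_mul_rpow`).

For a test function `h` descending from `1` to `0` with `|h'| ≤ 1 / a`, the solution of
`f' w - w * f w = h w - 𝔼 h(Z)` satisfies `|f'| ≤ 3` and has an `f'` that is Lipschitz with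
constant `3 (2 + 1 / a)` (`exists_steinSolution_of_hasDerivAt`). Both facts come from comparing a
solution of `g' = x g + K` with the supersolution `2 k / (1 + |x|)`: this is applied first to `f`,
then to `f'`, which solves the same equation with right-hand side `f + h'`. Interpolating, `f'` is
`θ`-Hölder with `θ = δ - 2` and constant `6 (1 + 1 / (2 a)) ^ θ`.

In `𝔼 [W f(W)] = ∑ k, 𝔼 [ξ k f(W)]`, subtract from `f(W)` the value at the sum outside the
neighbourhood of `k`, which is independent of `ξ k`, and expand to first order. This leaves
`∑ 𝔼 [ξ k ξ j f'(W)]` over neighbouring pairs. Each such term is decoupled into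
`𝔼 [ξ k ξ j] 𝔼 [f'(W)]` by passing to the sum outside both neighbourhoods, and the decoupled terms
add up to `𝔼 [f'(W)]` because `𝔼 W ^ 2 = 1`. All remainders are of order `δ` in the `ξ`'s, and
Young's inequality combined with counting neighbours bounds them by
`5 K m ^ (δ - 1) ∑ k, 𝔼 |ξ k| ^ δ`, with `K` the Hölder constant
(`abs_integral_steinOperator_le`).

Smoothing costs `2 a`, as the Gaussian density is at most `1`. With `a = x` the total is at most
`2 x + 240 x ^ 3`, which is less than `8.015 x` if `x < 1 / 8`; otherwise the bound exceeds `1` and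
is trivial.
-/

namespace DependencyGraphCLT

open Filter Topology

/-! ### The Stein equation for the standard Gaussian distribution -/

lemma stdGaussianPDF_eq (x : ℝ) :
    gaussianPDFReal 0 1 x = (√(2 * Real.pi))⁻¹ * Real.exp (-x ^ 2 / 2) := by
  simp [gaussianPDFReal]

lemma stdGaussianPDF_pos (x : ℝ) : 0 < gaussianPDFReal 0 1 x :=
  gaussianPDFReal_pos 0 1 x one_ne_zero

lemma stdGaussianPDF_neg (x : ℝ) : gaussianPDFReal 0 1 (-x) = gaussianPDFReal 0 1 x := by
  simp [stdGaussianPDF_eq]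

lemma hasDerivAt_stdGaussianPDF (x : ℝ) :
    HasDerivAt (gaussianPDFReal 0 1) (-x * gaussianPDFReal 0 1 x) x := by
  have h : HasDerivAt (fun y : ℝ => (√(2 * Real.pi))⁻¹ * Real.exp (-y ^ 2 / 2))
      ((√(2 * Real.pi))⁻¹ * (Real.exp (-x ^ 2 / 2) * (-(2 * x) / 2))) x := by
    have h1 : HasDerivAt (fun y : ℝ => -y ^ 2 / 2) (-(2 * x) / 2) x := by
      simpa using ((hasDerivAt_pow 2 x).neg.div_const 2)
    exact h1.exp.const_mul _
  convert h using 1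
  · exact funext stdGaussianPDF_eq
  · rw [stdGaussianPDF_eq]; ring

lemma continuous_stdGaussianPDF : Continuous (gaussianPDFReal 0 1) :=
  continuous_iff_continuousAt.2 fun x => (hasDerivAt_stdGaussianPDF x).continuousAt

lemma stdGaussianPDF_le_one (x : ℝ) : gaussianPDFReal 0 1 x ≤ 1 := by
  rw [stdGaussianPDF_eq]
  have h1 : (√(2 * Real.pi))⁻¹ ≤ 1 := by
    apply inv_le_one_of_one_le₀
    rw [Real.one_le_sqrt]
    linarith [Real.pi_gt_three]
  have h2 : Real.exp (-x ^ 2 / 2) ≤ 1 := by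
    rw [Real.exp_le_one_iff]; nlinarith [sq_nonneg x]
  exact mul_le_one₀ h1 (Real.exp_nonneg _) h2

lemma tendsto_stdGaussianPDF_atTop : Tendsto (gaussianPDFReal 0 1) atTop (𝓝 0) := by
  have h : Tendsto (fun x : ℝ => (√(2 * Real.pi))⁻¹ * Real.exp (-(x ^ 2 / 2))) atTop
      (𝓝 ((√(2 * Real.pi))⁻¹ * 0)) := by
    apply Tendsto.const_mul
    apply Real.tendsto_exp_neg_atTop_nhds_zero.comp
    exact (tendsto_pow_atTop two_ne_zero).atTop_div_const two_pos
  rw [mul_zero] at h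
  refine h.congr fun x => ?_
  rw [stdGaussianPDF_eq, neg_div]

lemma tendsto_stdGaussianPDF_atBot : Tendsto (gaussianPDFReal 0 1) atBot (𝓝 0) := by
  have h := tendsto_stdGaussianPDF_atTop.comp tendsto_neg_atBot_atTop
  exact h.congr fun x => stdGaussianPDF_neg x

/-- Comparison with the supersolution `c y = 2 * k / (1 + y)`, which satisfies
`c' y - y * c y ≤ -k` for `y ≥ 0`: the function `p * (g + c)`, with `p` the Gaussian density, is
antitone on `[0, ∞)` and vanishes at infinity. -/
lemma neg_le_of_steinEquation {g K : ℝ → ℝ} {k : ℝ} (hk : 0 ≤ k)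
    (hg : ∀ x, HasDerivAt g (x * g x + K x) x) (hK : ∀ x, K x ≤ k)
    (hlim : Tendsto (fun x => gaussianPDFReal 0 1 x * g x) atTop (𝓝 0)) {x : ℝ} (hx : 0 ≤ x) :
    -(2 * k / (1 + x)) ≤ g x := by
  set p := gaussianPDFReal 0 1 with hp
  let u : ℝ → ℝ := fun y => p y * (g y + 2 * k / (1 + y))
  have hu : ∀ y, 0 ≤ y → HasDerivAt u (p y * (K y - y * (2 * k / (1 + y))
      - 2 * k / (1 + y) ^ 2)) y := by
    intro y hy
    have h1 : (1 + y) ≠ 0 := by positivity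
    have hc : HasDerivAt (fun y : ℝ => 2 * k / (1 + y)) (-(2 * k) / (1 + y) ^ 2) y := by
      refine ((hasDerivAt_const y (2 * k)).div ((hasDerivAt_id y).const_add 1) h1).congr_deriv ?_
      simp
    refine ((hasDerivAt_stdGaussianPDF y).mul ((hg y).add hc)).congr_deriv ?_
    simp only [← hp, Pi.add_apply]
    ring
  have hanti : AntitoneOn u (Set.Ici 0) := by
    apply antitoneOn_of_deriv_nonpos (convex_Ici 0)
    · exact fun y hy => (hu y hy).continuousAt.continuousWithinAt
    · intro y hy
      rw [interior_Ici] at hy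
      exact (hu y (le_of_lt hy)).differentiableAt.differentiableWithinAt
    · intro y hy
      rw [interior_Ici] at hy
      have hy0 : 0 ≤ y := le_of_lt hy
      rw [(hu y hy0).deriv]
      apply mul_nonpos_of_nonneg_of_nonpos (stdGaussianPDF_pos y).le
      have h2 : k ≤ y * (2 * k / (1 + y)) + 2 * k / (1 + y) ^ 2 := by
        have : y * (2 * k / (1 + y)) + 2 * k / (1 + y) ^ 2 - k
            = k * (1 + y ^ 2) / (1 + y) ^ 2 := by
          field_simp; ring
        have h3 : 0 ≤ k * (1 + y ^ 2) / (1 + y) ^ 2 := by positivity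
        linarith
      linarith [hK y]
  have hulim : Tendsto u atTop (𝓝 0) := by
    have h1 : Tendsto (fun y : ℝ => 2 * k / (1 + y)) atTop (𝓝 0) :=
      tendsto_const_nhds.div_atTop (tendsto_atTop_add_const_left _ _ tendsto_id)
    have h2 := hlim.add (tendsto_stdGaussianPDF_atTop.mul h1)
    simp only [mul_zero, add_zero] at h2
    refine h2.congr fun y => ?_
    simp only [u, hp]; ring
  have h0 : 0 ≤ u x := by
    apply le_of_tendsto hulim
    filter_upwards [eventually_ge_atTop x] with y hy
    exact hanti hx (hx.trans hy : (0 : ℝ) ≤ y) hy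
  have h3 : 0 ≤ g x + 2 * k / (1 + x) := nonneg_of_mul_nonneg_right h0 (stdGaussianPDF_pos x)
  linarith

/-- A solution of `g' = x g + K` with `|K| ≤ k` that is negligible against the inverse Gaussian
density at both ends of the line is bounded by `2 k / (1 + |x|)`. -/
lemma abs_le_of_steinEquation {g K : ℝ → ℝ} {k : ℝ}
    (hg : ∀ x, HasDerivAt g (x * g x + K x) x) (hK : ∀ x, |K x| ≤ k)
    (htop : Tendsto (fun x => gaussianPDFReal 0 1 x * g x) atTop (𝓝 0))
    (hbot : Tendsto (fun x => gaussianPDFReal 0 1 x * g x) atBot (𝓝 0)) (x : ℝ) :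
    |g x| ≤ 2 * k / (1 + |x|) := by
  have hk : 0 ≤ k := (abs_nonneg _).trans (hK 0)
  have key : ∀ (g K : ℝ → ℝ), (∀ x, HasDerivAt g (x * g x + K x) x) → (∀ x, |K x| ≤ k) →
      Tendsto (fun x => gaussianPDFReal 0 1 x * g x) atTop (𝓝 0) → ∀ x, 0 ≤ x →
      |g x| ≤ 2 * k / (1 + x) := by
    intro g K hg hK ht x hx
    rw [abs_le]
    refine ⟨neg_le_of_steinEquation hk hg (fun x => (abs_le.1 (hK x)).2) ht hx, ?_⟩
    have h2 := neg_le_of_steinEquation (g := fun x => -g x) (K := fun x => -K x) hk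
      (fun x => (hg x).neg.congr_deriv (by ring))
      (fun x => by linarith [(abs_le.1 (hK x)).1]) (by simpa using ht.neg) hx
    linarith
  rcases le_total 0 x with hx | hx
  · rw [abs_of_nonneg hx]; exact key g K hg hK htop x hx
  -- The equation is invariant under `g x ↦ -g (-x)`, `K x ↦ K (-x)`.
  · have h := key (fun x => -g (-x)) (fun x => K (-x)) (fun y => ?_) (fun y => hK _) ?_ (-x)
      (by linarith)
    · simpa [abs_of_nonpos hx] using h
    · exact ((hg (-y)).comp y (hasDerivAt_neg y)).neg.congr_deriv (by ring)
    · have := (hbot.comp tendsto_neg_atTop_atBot).neg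
      simp only [neg_zero] at this
      refine this.congr fun y => ?_
      simp [stdGaussianPDF_neg]

lemma abs_deriv_le_of_steinEquation {g K : ℝ → ℝ} {k : ℝ}
    (hg : ∀ x, HasDerivAt g (x * g x + K x) x) (hK : ∀ x, |K x| ≤ k)
    (htop : Tendsto (fun x => gaussianPDFReal 0 1 x * g x) atTop (𝓝 0))
    (hbot : Tendsto (fun x => gaussianPDFReal 0 1 x * g x) atBot (𝓝 0)) (x : ℝ) :
    |x * g x + K x| ≤ 3 * k := by
  have hk : 0 ≤ k := (abs_nonneg _).trans (hK 0)
  have h1 := abs_le_of_steinEquation hg hK htop hbot x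
  have h2 : |x| * |g x| ≤ 2 * k := by
    calc |x| * |g x| ≤ |x| * (2 * k / (1 + |x|)) := by gcongr
      _ = 2 * k * (|x| / (1 + |x|)) := by ring
      _ ≤ 2 * k * 1 := by
        gcongr
        rw [div_le_one (by positivity)]; linarith
      _ = 2 * k := mul_one _
  calc |x * g x + K x| ≤ |x| * |g x| + |K x| := by rw [← abs_mul]; exact abs_add_le _ _
    _ ≤ 3 * k := by linarith [hK x]

/-- Existence of the solution `f x = (∫ y in Iic x, H y * p y) / p x` of the Stein equation
`f' - x f = H`, where `p` is the Gaussian density and `H` has Gaussian mean zero. -/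
lemma exists_steinSolution {H : ℝ → ℝ} (hH : Continuous H) {M : ℝ} (hM : ∀ x, |H x| ≤ M)
    (h0 : ∫ x, gaussianPDFReal 0 1 x * H x = 0) :
    ∃ f : ℝ → ℝ, (∀ x, HasDerivAt f (x * f x + H x) x) ∧
      Tendsto (fun x => gaussianPDFReal 0 1 x * f x) atTop (𝓝 0) ∧
      Tendsto (fun x => gaussianPDFReal 0 1 x * f x) atBot (𝓝 0) := by
  set p := gaussianPDFReal 0 1 with hp
  have hcont : Continuous fun x => p x * H x := continuous_stdGaussianPDF.mul hH
  have hint : Integrable fun x => p x * H x := by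
    refine (integrable_gaussianPDFReal 0 1).mul_bdd (c := M) hH.aestronglyMeasurable ?_
    exact Eventually.of_forall fun x => by simpa using hM x
  let F : ℝ → ℝ := fun x => (∫ y in Set.Iic 0, p y * H y) + ∫ y in (0 : ℝ)..x, p y * H y
  have hF : ∀ x, HasDerivAt F (p x * H x) x := fun x =>
    (intervalIntegral.integral_hasDerivAt_right (hcont.intervalIntegrable _ _)
      (hcont.stronglyMeasurableAtFilter _ _) hcont.continuousAt).const_add _
  have hpne : ∀ x, p x ≠ 0 := fun x => (stdGaussianPDF_pos x).ne'
  refine ⟨fun x => F x / p x, fun x => ?_, ?_, ?_⟩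
  · refine ((hF x).div (hasDerivAt_stdGaussianPDF x) (hpne x)).congr_deriv ?_
    have := hpne x
    rw [← hp]
    field_simp
    ring
  · have hlim : Tendsto F atTop (𝓝 0) := by
      have h1 := intervalIntegral_tendsto_integral_Ioi 0 hint.integrableOn
        (tendsto_id (α := ℝ) (x := atTop))
      have h2 := h1.const_add (∫ y in Set.Iic 0, p y * H y)
      rwa [intervalIntegral.integral_Iic_add_Ioi hint.integrableOn hint.integrableOn, h0] at h2
    refine hlim.congr fun x => ?_
    have := hpne x
    field_simp
  · have hlim : Tendsto F atBot (𝓝 0) := by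
      have h1 := intervalIntegral_tendsto_integral_Iic 0 hint.integrableOn
        (tendsto_id (α := ℝ) (x := atBot))
      have h2 := h1.const_sub (∫ y in Set.Iic 0, p y * H y)
      rw [sub_self] at h2
      refine h2.congr fun x => ?_
      simp only [F, id]
      rw [intervalIntegral.integral_symm 0 x, sub_neg_eq_add]
    refine hlim.congr fun x => ?_
    have := hpne x
    field_simp

/-- The Stein equation for a test function `h` with values in `[0, 1]` and derivative bounded by
`b`: it has a solution whose first two derivatives are controlled. The bound on the second
derivative comes from the fact that `f'` solves the Stein equation with right-hand side
`f + h'`. -/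
theorem exists_steinSolution_of_hasDerivAt {h h' : ℝ → ℝ} {b : ℝ}
    (hd : ∀ x, HasDerivAt h (h' x) x) (h01 : ∀ x, h x ∈ Set.Icc (0 : ℝ) 1)
    (hb : ∀ x, |h' x| ≤ b) :
    ∃ f f' : ℝ → ℝ, (∀ x, HasDerivAt f (f' x) x) ∧
      (∀ x, f' x - x * f x = h x - ∫ y, h y ∂(gaussianReal 0 1)) ∧
      (∀ x, |f x| ≤ 2) ∧ (∀ x, |f' x| ≤ 3) ∧ Continuous f' ∧
      ∀ x y, |f' x - f' y| ≤ 3 * (2 + b) * |x - y| := by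
  have hcont : Continuous h := continuous_iff_continuousAt.2 fun x => (hd x).continuousAt
  set m := ∫ y, h y ∂(gaussianReal 0 1) with hm
  have hbd : ∀ x, ‖h x‖ ≤ 1 := fun x => by
    rw [Real.norm_eq_abs, abs_of_nonneg (h01 x).1]; exact (h01 x).2
  have hm0 : 0 ≤ m := integral_nonneg fun x => (h01 x).1
  have hm1 : m ≤ 1 := by
    have := norm_integral_le_of_norm_le_const (μ := gaussianReal 0 1) (Eventually.of_forall hbd)
    simp only [probReal_univ, mul_one] at this
    exact (le_abs_self _).trans this
  have hH1 : ∀ x, |h x - m| ≤ 1 := fun x => by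
    rw [abs_le]; constructor <;> linarith [(h01 x).1, (h01 x).2]
  have hH0 : ∫ x, gaussianPDFReal 0 1 x * (h x - m) = 0 := by
    have h1 := integral_gaussianReal_eq_integral_smul (μ := 0) (v := 1) one_ne_zero
      (f := fun x => h x - m)
    simp only [smul_eq_mul] at h1
    rw [← h1, integral_sub _ (integrable_const _)]
    · simp [hm]
    · exact Integrable.of_bound hcont.aestronglyMeasurable 1 (Eventually.of_forall hbd)
  obtain ⟨f, hf, htop, hbot⟩ := exists_steinSolution (H := fun x => h x - m)
    (hcont.sub continuous_const) hH1 hH0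
  have hf1 : ∀ x, |x * f x + (h x - m)| ≤ 3 := fun x => by
    simpa using abs_deriv_le_of_steinEquation hf hH1 htop hbot x
  have hf0 : ∀ x, |f x| ≤ 2 := fun x => by
    refine (abs_le_of_steinEquation hf hH1 htop hbot x).trans ?_
    rw [mul_one]
    exact div_le_self (by norm_num) (by linarith [abs_nonneg x])
  set f' : ℝ → ℝ := fun x => x * f x + (h x - m) with hf'
  have hf2 : ∀ x, HasDerivAt f' (x * f' x + (f x + h' x)) x := fun x => by
    refine (((hasDerivAt_id x).mul (hf x)).add ((hd x).sub_const m)).congr_deriv ?_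
    simp only [id, hf']; ring
  have hK : ∀ x, |f x + h' x| ≤ 2 + b := fun x =>
    (abs_add_le _ _).trans (add_le_add (hf0 x) (hb x))
  have hlim : ∀ l : Filter ℝ, Tendsto (gaussianPDFReal 0 1) l (𝓝 0) →
      Tendsto (fun x => gaussianPDFReal 0 1 x * f' x) l (𝓝 0) := by
    intro l hl
    exact hl.zero_mul_isBoundedUnder_le
      (isBoundedUnder_of ⟨3, fun x => by simpa using hf1 x⟩)
  have hf3 := abs_deriv_le_of_steinEquation hf2 hK (hlim _ tendsto_stdGaussianPDF_atTop)
    (hlim _ tendsto_stdGaussianPDF_atBot)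
  refine ⟨f, f', hf, fun x => by simp only [hf']; ring, hf0, hf1,
    continuous_iff_continuousAt.2 fun x => (hf2 x).continuousAt, fun x y => ?_⟩
  have := convex_univ.norm_image_sub_le_of_norm_hasDerivWithin_le (f := f')
    (C := 3 * (2 + b)) (fun x _ => (hf2 x).hasDerivWithinAt)
    (fun x _ => by simpa using hf3 x) (Set.mem_univ y) (Set.mem_univ x)
  simpa using this

/-! ### Smoothed indicator functions of half-lines -/

/-- The square of the positive part; it is continuously differentiable. -/
noncomputable def sqPos (x : ℝ) : ℝ := max x 0 ^ 2

lemma hasDerivAt_sqPos (x : ℝ) : HasDerivAt sqPos (2 * max x 0) x := by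
  rcases lt_trichotomy x 0 with hx | hx | hx
  · rw [max_eq_right hx.le, mul_zero]
    refine (hasDerivAt_const x (0 : ℝ)).congr_of_eventuallyEq ?_
    filter_upwards [gt_mem_nhds hx] with y hy
    simp [sqPos, max_eq_right hy.le]
  · subst hx
    rw [max_self, mul_zero, hasDerivAt_iff_isLittleO_nhds_zero]
    have h1 : (fun y : ℝ => sqPos (0 + y) - sqPos 0 - y • (0 : ℝ)) =O[𝓝 0] fun y : ℝ => y ^ 2 := by
      apply Asymptotics.IsBigO.of_bound 1
      filter_upwards with y
      simp only [sqPos, zero_add, max_self, smul_zero, sub_zero, one_mul, norm_pow,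
        Real.norm_eq_abs, ne_eq, OfNat.ofNat_ne_zero, not_false_eq_true, zero_pow]
      refine pow_le_pow_left₀ (abs_nonneg _) ?_ 2
      rcases le_total y 0 with h | h
      · simp [max_eq_right h]
      · simp [max_eq_left h]
    exact h1.trans_isLittleO (Asymptotics.isLittleO_pow_id one_lt_two)
  · rw [max_eq_left hx.le]
    have := hasDerivAt_pow 2 x
    simp only [Nat.cast_ofNat, Nat.add_one_sub_one, pow_one] at this
    refine this.congr_of_eventuallyEq ?_
    filter_upwards [lt_mem_nhds hx] with y hy
    simp [sqPos, max_eq_left hy.le]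

/-- For every half-line `(-∞, z]` and every `a > 0` there is a differentiable function that
interpolates between the indicators of `(-∞, z]` and `(-∞, z + 2 a]`, with derivative at most
`1 / a` in absolute value. -/
lemma exists_smooth_indicator (z : ℝ) {a : ℝ} (ha : 0 < a) :
    ∃ h h' : ℝ → ℝ, (∀ x, HasDerivAt h (h' x) x) ∧ (∀ x, h x ∈ Set.Icc (0 : ℝ) 1) ∧
      (∀ x, |h' x| ≤ 1 / a) ∧ (∀ x ≤ z, h x = 1) ∧ ∀ x, z + 2 * a ≤ x → h x = 0 := by
  -- `k` is the profile for `z = 0`, `a = 1`; its derivative is minus the tent function.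
  let k : ℝ → ℝ := fun u => 1 - (sqPos u - 2 * sqPos (u - 1) + sqPos (u - 2)) / 2
  let k' : ℝ → ℝ := fun u => -(max u 0 - 2 * max (u - 1) 0 + max (u - 2) 0)
  have hk : ∀ u, HasDerivAt k (k' u) u := fun u => by
    have h1 := (hasDerivAt_sqPos (u - 1)).comp_sub_const u 1
    have h2 := (hasDerivAt_sqPos (u - 2)).comp_sub_const u 2
    refine ((((hasDerivAt_sqPos u).sub (h1.const_mul 2)).add h2).div_const 2).const_sub 1
      |>.congr_deriv ?_
    simp only [k']; ring
  have hcases : ∀ u : ℝ, (u ≤ 0 ∧ k u = 1 ∧ k' u = 0) ∨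
      (0 ≤ u ∧ u ≤ 1 ∧ k u = 1 - u ^ 2 / 2 ∧ k' u = -u) ∨
      (1 ≤ u ∧ u ≤ 2 ∧ k u = (2 - u) ^ 2 / 2 ∧ k' u = u - 2) ∨ (2 ≤ u ∧ k u = 0 ∧ k' u = 0) := by
    intro u
    simp only [k, k', sqPos]
    rcases le_total u 0 with h | h
    · left
      rw [max_eq_right h, max_eq_right (by linarith), max_eq_right (by linarith)]
      exact ⟨h, by ring, by ring⟩
    rcases le_total u 1 with h1 | h1
    · right; left
      rw [max_eq_left h, max_eq_right (by linarith), max_eq_right (by linarith)]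
      exact ⟨h, h1, by ring, by ring⟩
    rcases le_total u 2 with h2 | h2
    · right; right; left
      rw [max_eq_left h, max_eq_left (by linarith), max_eq_right (by linarith)]
      exact ⟨h1, h2, by ring, by ring⟩
    · right; right; right
      rw [max_eq_left h, max_eq_left (by linarith), max_eq_left (by linarith)]
      exact ⟨h2, by ring, by ring⟩
  refine ⟨fun x => k ((x - z) / a), fun x => k' ((x - z) / a) * (1 / a), fun x => ?_, fun x => ?_,
    fun x => ?_, fun x hx => ?_, fun x hx => ?_⟩
  · have h1 : HasDerivAt (fun x : ℝ => (x - z) / a) (1 / a) x :=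
      ((hasDerivAt_id x).sub_const z).div_const a
    exact (hk _).comp x h1
  · simp only [Set.mem_Icc]
    rcases hcases ((x - z) / a) with ⟨_, h2, _⟩ | ⟨h0, h1, h2, _⟩ | ⟨h0, h1, h2, _⟩ | ⟨_, h2, _⟩ <;>
      rw [h2] <;> constructor <;> nlinarith
  · rw [abs_mul, abs_of_pos (by positivity : 0 < 1 / a)]
    apply mul_le_of_le_one_left (by positivity)
    rw [abs_le]
    rcases hcases ((x - z) / a) with ⟨_, _, h2⟩ | ⟨h0, h1, _, h2⟩ | ⟨h0, h1, _, h2⟩ | ⟨_, _, h2⟩ <;>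
      rw [h2] <;> constructor <;> linarith
  · have : (x - z) / a ≤ 0 := div_nonpos_of_nonpos_of_nonneg (by linarith) ha.le
    rcases hcases ((x - z) / a) with ⟨_, h2, _⟩ | ⟨h0, h1, h2, _⟩ | ⟨h0, h1, h2, _⟩ | ⟨h0, h2, _⟩
    · exact h2
    · refine h2.trans ?_; rw [le_antisymm this h0]; norm_num
    · linarith
    · linarith
  · have : 2 ≤ (x - z) / a := by rw [le_div_iff₀ ha]; linarith
    rcases hcases ((x - z) / a) with ⟨h0, h2, _⟩ | ⟨h0, h1, h2, _⟩ | ⟨h0, h1, h2, _⟩ | ⟨_, h2, _⟩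
    · linarith
    · linarith
    · refine h2.trans ?_; rw [le_antisymm h1 this]; norm_num
    · exact h2

/-! ### From smooth test functions to the Kolmogorov distance -/

lemma gaussianReal_real_Iic_sub_le {s t : ℝ} (h : s ≤ t) :
    (gaussianReal 0 1).real (Set.Iic t) - (gaussianReal 0 1).real (Set.Iic s) ≤ t - s := by
  have h1 : (gaussianReal 0 1).real (Set.Iic t) - (gaussianReal 0 1).real (Set.Iic s)
      = (gaussianReal 0 1).real (Set.Ioc s t) := by
    rw [← Set.Ioi_inter_Iic, Set.inter_comm, ← Set.compl_Iic, ← Set.sdiff_eq,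
      measureReal_sdiff (Set.Iic_subset_Iic.2 h) measurableSet_Iic]
  rw [h1, measureReal_def, gaussianReal_apply_eq_integral 0 one_ne_zero,
    ENNReal.toReal_ofReal (integral_nonneg fun x => (stdGaussianPDF_pos x).le)]
  calc ∫ x in Set.Ioc s t, gaussianPDFReal 0 1 x ≤ ∫ _ in Set.Ioc s t, (1 : ℝ) := by
        apply integral_mono (integrable_gaussianPDFReal 0 1).integrableOn
          (integrable_const _) stdGaussianPDF_le_one
    _ = t - s := by simp [measureReal_def, h]

/-- If `μ` is close to the Gaussian distribution when tested against smooth approximations, with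
derivative at most `1 / a`, of indicators of half-lines, then it is close in Kolmogorov
distance. -/
theorem kolmogorovDist_gaussianReal_le (μ : Measure ℝ) [IsProbabilityMeasure μ] {a ε : ℝ}
    (ha : 0 < a)
    (H : ∀ h h' : ℝ → ℝ, (∀ x, HasDerivAt h (h' x) x) → (∀ x, h x ∈ Set.Icc (0 : ℝ) 1) →
      (∀ x, |h' x| ≤ 1 / a) → |∫ x, h x ∂μ - ∫ x, h x ∂(gaussianReal 0 1)| ≤ ε) :
    kolmogorovDist μ (gaussianReal 0 1) ≤ 2 * a + ε := by
  have sandwich : ∀ (ν : Measure ℝ) [IsProbabilityMeasure ν] (h : ℝ → ℝ) (z : ℝ), Continuous h →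
      (∀ x, h x ∈ Set.Icc (0 : ℝ) 1) → (∀ x ≤ z, h x = 1) → (∀ x, z + 2 * a ≤ x → h x = 0) →
      ν.real (Set.Iic z) ≤ ∫ x, h x ∂ν ∧ ∫ x, h x ∂ν ≤ ν.real (Set.Iic (z + 2 * a)) := by
    intro ν _ h z hc h01 h1 h0
    have hint : Integrable h ν := Integrable.of_bound hc.aestronglyMeasurable 1
      (Eventually.of_forall fun x => by
        rw [Real.norm_eq_abs, abs_of_nonneg (h01 x).1]; exact (h01 x).2)
    rw [← integral_indicator_one measurableSet_Iic, ← integral_indicator_one measurableSet_Iic]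
    constructor
    · refine integral_mono ((integrable_const 1).indicator measurableSet_Iic) hint fun x => ?_
      by_cases hx : x ≤ z
      · simp [hx, h1 x hx]
      · simpa [hx] using (h01 x).1
    · refine integral_mono hint ((integrable_const 1).indicator measurableSet_Iic) fun x => ?_
      by_cases hx : x ≤ z + 2 * a
      · simpa [hx] using (h01 x).2
      · simp [hx, h0 x (not_le.1 hx).le]
  refine ciSup_le fun t => ?_
  rw [abs_le]
  constructor
  · obtain ⟨h, h', hd, h01, hb, h1, h0⟩ := exists_smooth_indicator (t - 2 * a) ha
    have hc : Continuous h := continuous_iff_continuousAt.2 fun x => (hd x).continuousAt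
    have e1 := (sandwich μ h _ hc h01 h1 h0).2
    have e2 := (sandwich (gaussianReal 0 1) h _ hc h01 h1 h0).1
    have e3 := (abs_le.1 (H h h' hd h01 hb)).1
    have e4 := gaussianReal_real_Iic_sub_le (by linarith : t - 2 * a ≤ t)
    rw [sub_add_cancel] at e1
    linarith
  · obtain ⟨h, h', hd, h01, hb, h1, h0⟩ := exists_smooth_indicator t ha
    have hc : Continuous h := continuous_iff_continuousAt.2 fun x => (hd x).continuousAt
    have e1 := (sandwich μ h _ hc h01 h1 h0).1
    have e2 := (sandwich (gaussianReal 0 1) h _ hc h01 h1 h0).2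
    have e3 := (abs_le.1 (H h h' hd h01 hb)).2
    have e4 := gaussianReal_real_Iic_sub_le (by linarith : t ≤ t + 2 * a)
    linarith

/-! ### Neighbourhoods in a multigraph -/

open scoped Classical in
/-- The closed neighbourhood of a vertex: the vertex itself and the vertices joined to it by an
edge. -/
noncomputable def nbhd {V : Type*} [Fintype V] (E : Multiset (Sym2 V)) (k : V) : Finset V :=
  Finset.univ.filter fun j => j = k ∨ s(k, j) ∈ E

section Graph

variable {V : Type*} [Fintype V] (E : Multiset (Sym2 V))

lemma mem_nbhd {j k : V} : j ∈ nbhd E k ↔ j = k ∨ s(k, j) ∈ E := by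
  simp [nbhd]

lemma mem_nbhd_self (k : V) : k ∈ nbhd E k := (mem_nbhd E).2 (Or.inl rfl)

lemma mem_nbhd_comm {j k : V} : j ∈ nbhd E k ↔ k ∈ nbhd E j := by
  rw [mem_nbhd, mem_nbhd, Sym2.eq_swap, eq_comm]

lemma card_nbhd_le (k : V) : (nbhd E k).card ≤ maxDegree E + 1 := by
  classical
  have h1 : (Finset.univ.filter fun j : V => s(k, j) ∈ E).card ≤ degree E k := by
    rw [degree, Multiset.countP_eq_card_filter]
    refine le_trans ?_ (Multiset.toFinset_card_le _)
    apply Finset.card_le_card_of_injOn (fun j => s(k, j))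
    · intro j hj
      have : s(k, j) ∈ E := by simpa using hj
      simp [this]
    · intro i _ j _ hij
      exact Sym2.congr_right.1 hij
  have h2 : degree E k ≤ maxDegree E := Finset.le_sup (f := degree E) (Finset.mem_univ k)
  have h3 : nbhd E k ⊆ insert k (Finset.univ.filter fun j : V => s(k, j) ∈ E) := by
    intro j hj
    simpa using (mem_nbhd E).1 hj
  calc (nbhd E k).card ≤ _ := Finset.card_le_card h3
    _ ≤ _ + 1 := Finset.card_insert_le _ _
    _ ≤ maxDegree E + 1 := by omega

lemma sum_sum_nbhd_comm (b : V → V → ℝ) :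
    ∑ k, ∑ j ∈ nbhd E k, b k j = ∑ j, ∑ k ∈ nbhd E j, b k j :=
  Finset.sum_comm' fun k j => by simp [mem_nbhd_comm E (j := j) (k := k)]

variable {E}

lemma sum_sum_nbhd_left_le {m : ℝ} (hm : ∀ k, ((nbhd E k).card : ℝ) ≤ m) {b : V → ℝ}
    (hb : ∀ k, 0 ≤ b k) : ∑ k, ∑ _j ∈ nbhd E k, b k ≤ m * ∑ k, b k := by
  rw [Finset.mul_sum]
  refine Finset.sum_le_sum fun k _ => ?_
  rw [Finset.sum_const, nsmul_eq_mul]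
  exact mul_le_mul_of_nonneg_right (hm k) (hb k)

lemma sum_sum_nbhd_right_le {m : ℝ} (hm : ∀ k, ((nbhd E k).card : ℝ) ≤ m) {b : V → ℝ}
    (hb : ∀ k, 0 ≤ b k) : ∑ k, ∑ j ∈ nbhd E k, b j ≤ m * ∑ k, b k := by
  rw [sum_sum_nbhd_comm]
  exact sum_sum_nbhd_left_le hm hb

open scoped Classical in
lemma sum_sum_nbhd_union_le {m : ℝ} (hm : ∀ k, ((nbhd E k).card : ℝ) ≤ m) {b : V → ℝ}
    (hb : ∀ k, 0 ≤ b k) :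
    ∑ k, ∑ j ∈ nbhd E k, ∑ i ∈ nbhd E k ∪ nbhd E j, b i ≤ 2 * m ^ 2 * ∑ k, b k := by
  have hb' : ∀ k, 0 ≤ ∑ i ∈ nbhd E k, b i := fun k => Finset.sum_nonneg fun i _ => hb i
  rcases isEmpty_or_nonempty V with hV | ⟨⟨k₀⟩⟩
  · simp
  have hm0 : 0 ≤ m := (Nat.cast_nonneg _).trans (hm k₀)
  have h1 : ∀ k j, ∑ i ∈ nbhd E k ∪ nbhd E j, b i ≤ ∑ i ∈ nbhd E k, b i + ∑ i ∈ nbhd E j, b i := by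
    intro k j
    rw [← Finset.sum_union_inter]
    exact le_add_of_nonneg_right (Finset.sum_nonneg fun i _ => hb i)
  calc ∑ k, ∑ j ∈ nbhd E k, ∑ i ∈ nbhd E k ∪ nbhd E j, b i
      ≤ ∑ k, ∑ j ∈ nbhd E k, (∑ i ∈ nbhd E k, b i + ∑ i ∈ nbhd E j, b i) :=
        Finset.sum_le_sum fun k _ => Finset.sum_le_sum fun j _ => h1 k j
    _ = ∑ k, ∑ _j ∈ nbhd E k, ∑ i ∈ nbhd E k, b i + ∑ k, ∑ j ∈ nbhd E k, ∑ i ∈ nbhd E j, b i := by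
        simp only [Finset.sum_add_distrib]
    _ ≤ m * ∑ k, ∑ i ∈ nbhd E k, b i + m * ∑ k, ∑ i ∈ nbhd E k, b i :=
        add_le_add (sum_sum_nbhd_left_le hm hb') (sum_sum_nbhd_right_le hm hb')
    _ = 2 * m * ∑ k, ∑ i ∈ nbhd E k, b i := by ring
    _ ≤ 2 * m * (m * ∑ k, b k) := by gcongr; exact sum_sum_nbhd_right_le hm hb
    _ = 2 * m ^ 2 * ∑ k, b k := by ring

open scoped Classical in
/-- The variables indexed by `A` are independent of the sum of the variables indexed by the
vertices outside the closed neighbourhood of `A`. -/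
lemma IsDependencyGraph.indepFun_sum_compl {Ω : Type*} [MeasurableSpace Ω] {P : Measure Ω}
    {Y : V → Ω → ℝ} (hE : IsDependencyGraph E Y P) (A B : Finset V)
    (hB : ∀ k ∈ A, nbhd E k ⊆ B) :
    IndepFun (fun ω (i : A) => Y i ω) (fun ω => ∑ i ∈ Bᶜ, Y i ω) P := by
  have h := hE A Bᶜ ?_ ?_
  · have h2 := h.comp measurable_id
      (show Measurable fun v : (Bᶜ : Finset V) → ℝ => ∑ i, v i by fun_prop)
    refine h2.congr (Filter.EventuallyEq.rfl) (Filter.Eventually.of_forall fun ω => ?_)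
    simp only [Function.comp]
    exact Finset.sum_coe_sort Bᶜ fun i => Y i ω
  · rw [Finset.disjoint_left]
    intro k hk hk'
    exact (Finset.mem_compl.1 hk') (hB k hk (mem_nbhd_self E k))
  · intro i hi j hj hij
    exact (Finset.mem_compl.1 hj) (hB i hi ((mem_nbhd E).2 (Or.inr hij)))

end Graph

/-! ### Inequalities for power means -/

/-- Young's inequality for three factors with exponents `2 + θ`, `2 + θ` and `(2 + θ) / θ`. -/
lemma young_mul_mul_rpow {θ a b t : ℝ} (hθ : 0 < θ) (ha : 0 ≤ a) (hb : 0 ≤ b) (ht : 0 ≤ t) :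
    a * b * t ^ θ ≤ (a ^ (2 + θ) + b ^ (2 + θ) + θ * t ^ (2 + θ)) / (2 + θ) := by
  have hδ : (2 + θ) ≠ 0 := by positivity
  have h := Real.geom_mean_le_arith_mean3_weighted (w₁ := 1 / (2 + θ)) (w₂ := 1 / (2 + θ))
    (w₃ := θ / (2 + θ)) (p₁ := a ^ (2 + θ)) (p₂ := b ^ (2 + θ)) (p₃ := t ^ (2 + θ))
    (by positivity) (by positivity) (by positivity) (by positivity) (by positivity)
    (by positivity) (by field_simp; ring)
  rw [← Real.rpow_mul ha, ← Real.rpow_mul hb, ← Real.rpow_mul ht, mul_one_div_cancel hδ,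
    mul_div_cancel₀ _ hδ, Real.rpow_one, Real.rpow_one] at h
  refine h.trans_eq ?_
  ring

/-- Jensen's inequality for a sum of at most `M` terms, divided by `M`. -/
lemma rpow_abs_sum_div_le {ι : Type*} (s : Finset ι) (x : ι → ℝ) {M p : ℝ} (hp : 1 ≤ p)
    (hM : 0 < M) (hs : (s.card : ℝ) ≤ M) :
    (|∑ i ∈ s, x i| / M) ^ p ≤ M⁻¹ * ∑ i ∈ s, |x i| ^ p := by
  rw [Real.div_rpow (abs_nonneg _) hM.le, div_le_iff₀ (by positivity)]
  have h1 : |∑ i ∈ s, x i| ^ p ≤ (s.card : ℝ) ^ (p - 1) * ∑ i ∈ s, |x i| ^ p :=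
    le_trans (Real.rpow_le_rpow (abs_nonneg _) (Finset.abs_sum_le_sum_abs _ _) (by linarith))
      (Real.rpow_sum_le_const_mul_sum_rpow s x hp)
  have h0 : 0 ≤ ∑ i ∈ s, |x i| ^ p := Finset.sum_nonneg fun i _ => by positivity
  calc |∑ i ∈ s, x i| ^ p ≤ (s.card : ℝ) ^ (p - 1) * ∑ i ∈ s, |x i| ^ p := h1
    _ ≤ M ^ (p - 1) * ∑ i ∈ s, |x i| ^ p := by gcongr
    _ = M⁻¹ * (∑ i ∈ s, |x i| ^ p) * M ^ p := by
      rw [Real.rpow_sub_one hM.ne']; field_simp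

/-- Pointwise bound for the remainders of second order. -/
lemma abs_mul_rpow_abs_sum_le {ι : Type*} (s : Finset ι) (x : ι → ℝ) (k : ι) {M θ : ℝ}
    (hθ : 0 < θ) (hM : 0 < M) (hs : (s.card : ℝ) ≤ M) :
    |x k| * |∑ i ∈ s, x i| ^ (1 + θ) ≤ M ^ (1 + θ) *
      ((|x k| ^ (2 + θ) + (1 + θ) * (M⁻¹ * ∑ i ∈ s, |x i| ^ (2 + θ))) / (2 + θ)) := by
  set t := |∑ i ∈ s, x i| / M with ht
  have ht0 : 0 ≤ t := by positivity
  have h1 : |∑ i ∈ s, x i| = M * t := by rw [ht]; field_simp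
  have h2 := young_mul_mul_rpow hθ (abs_nonneg (x k)) ht0 ht0
  have h3 := rpow_abs_sum_div_le s x (by linarith : 1 ≤ 2 + θ) hM hs
  rw [← ht] at h3
  rw [h1, Real.mul_rpow hM.le ht0]
  have h4 : |x k| * t ^ (1 + θ) = |x k| * t * t ^ θ := by
    rw [Real.rpow_add_of_nonneg ht0 zero_le_one hθ.le, Real.rpow_one]; ring
  calc |x k| * (M ^ (1 + θ) * t ^ (1 + θ)) = M ^ (1 + θ) * (|x k| * t * t ^ θ) := by
        rw [← h4]; ring
    _ ≤ M ^ (1 + θ) * ((|x k| ^ (2 + θ) + t ^ (2 + θ) + θ * t ^ (2 + θ)) / (2 + θ)) := by gcongr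
    _ = M ^ (1 + θ) * ((|x k| ^ (2 + θ) + (1 + θ) * t ^ (2 + θ)) / (2 + θ)) := by ring
    _ ≤ _ := by gcongr

/-- Pointwise bound for the remainders attached to a pair of variables; the values `x k`, `x j`
and the sum of the `y i` may be taken at different points of the probability space. -/
lemma abs_mul_mul_rpow_abs_sum_le {ι : Type*} (s : Finset ι) (y : ι → ℝ) (a b : ℝ) {M θ : ℝ}
    (hθ : 0 < θ) (hM : 0 < M) (hs : (s.card : ℝ) ≤ M) :
    |a * b| * |∑ i ∈ s, y i| ^ θ ≤ M ^ θ *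
      ((|a| ^ (2 + θ) + |b| ^ (2 + θ) + θ * (M⁻¹ * ∑ i ∈ s, |y i| ^ (2 + θ))) / (2 + θ)) := by
  set t := |∑ i ∈ s, y i| / M with ht
  have ht0 : 0 ≤ t := by positivity
  have h1 : |∑ i ∈ s, y i| = M * t := by rw [ht]; field_simp
  have h2 := young_mul_mul_rpow hθ (abs_nonneg a) (abs_nonneg b) ht0
  have h3 := rpow_abs_sum_div_le s y (by linarith : 1 ≤ 2 + θ) hM hs
  rw [← ht] at h3
  rw [h1, Real.mul_rpow hM.le ht0, abs_mul]
  calc |a| * |b| * (M ^ θ * t ^ θ) = M ^ θ * (|a| * |b| * t ^ θ) := by ring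
    _ ≤ M ^ θ * ((|a| ^ (2 + θ) + |b| ^ (2 + θ) + θ * t ^ (2 + θ)) / (2 + θ)) := by gcongr
    _ ≤ _ := by gcongr

/-- First-order Taylor bound for a function with Hölder continuous derivative. -/
lemma abs_sub_sub_mul_le_of_holder {f f' : ℝ → ℝ} {K θ : ℝ} (hθ : 0 ≤ θ) (hK : 0 ≤ K)
    (hf : ∀ x, HasDerivAt f (f' x) x) (hH : ∀ x y, |f' x - f' y| ≤ K * |x - y| ^ θ) (x y : ℝ) :
    |f x - f y - (x - y) * f' x| ≤ K * |x - y| ^ (1 + θ) := by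
  have h1 : ∀ u, HasDerivAt (fun u => f u - u * f' x) (f' u - f' x) u := fun u =>
    ((hf u).sub ((hasDerivAt_id u).mul_const (f' x))).congr_deriv (by ring)
  have h2 := (convex_uIcc y x).norm_image_sub_le_of_norm_hasDerivWithin_le
    (f := fun u => f u - u * f' x) (C := K * |x - y| ^ θ)
    (fun u _ => (h1 u).hasDerivWithinAt) (fun u hu => ?_) Set.left_mem_uIcc Set.right_mem_uIcc
  · rw [Real.norm_eq_abs, Real.norm_eq_abs] at h2
    have h3 : f x - x * f' x - (f y - y * f' x) = f x - f y - (x - y) * f' x := by ring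
    rw [h3] at h2
    refine h2.trans_eq ?_
    rw [Real.rpow_add_of_nonneg (abs_nonneg _) zero_le_one hθ, Real.rpow_one]; ring
  · refine (hH u x).trans ?_
    have : |u - x| ≤ |x - y| := by
      rw [abs_sub_comm u x, abs_sub_comm x y, abs_sub_comm x u]
      have := Set.abs_sub_right_of_mem_uIcc hu
      rw [abs_sub_comm]
      rwa [abs_sub_comm x y] at this
    gcongr

/-! ### Stein's method for a dependency graph -/

lemma integrable_rpow_abs_of_memLp {Ω : Type*} [MeasurableSpace Ω] {P : Measure Ω} {θ : ℝ}
    (hθ : 0 < θ) {X : Ω → ℝ}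
    (hX : MemLp X (ENNReal.ofReal (2 + θ)) P) : Integrable (fun ω => |X ω| ^ (2 + θ)) P := by
  have h := hX.integrable_norm_rpow (by simp; linarith) ENNReal.ofReal_ne_top
  rwa [ENNReal.toReal_ofReal (by linarith)] at h

lemma memLp_two_of_memLp {Ω : Type*} [MeasurableSpace Ω] {P : Measure Ω}
    [IsProbabilityMeasure P] {θ : ℝ} (hθ : 0 < θ) {X : Ω → ℝ}
    (hX : MemLp X (ENNReal.ofReal (2 + θ)) P) : MemLp X 2 P := by
  refine hX.mono_exponent ?_
  rw [← ENNReal.ofReal_ofNat]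
  exact ENNReal.ofReal_le_ofReal (by linarith)

open scoped Classical in
lemma sub_sum_compl {V Ω : Type*} [Fintype V] {ξ : V → Ω → ℝ} (B : Finset V) (ω : Ω) :
    ∑ i, ξ i ω - ∑ i ∈ Bᶜ, ξ i ω = ∑ i ∈ B, ξ i ω := by
  rw [← Finset.sum_add_sum_compl B, add_sub_cancel_right]

section Stein

open scoped Classical

variable {V Ω : Type*} [Fintype V] [MeasurableSpace Ω] {P : Measure Ω}
  {ξ : V → Ω → ℝ} {E : Multiset (Sym2 V)} {m θ : ℝ} {f f' : ℝ → ℝ} {K : ℝ}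

/-- Replacing `f (W)` by its first-order expansion: as `ξ k` is centred and independent of the sum
outside the neighbourhood of `k`, only the increment of `f` matters. -/
lemma abs_integral_mul_sub_le [IsProbabilityMeasure P] (hξm : ∀ k, Measurable (ξ k))
    (hξ : ∀ k, MemLp (ξ k) (ENNReal.ofReal (2 + θ)) P) (h0 : ∀ k, ∫ ω, ξ k ω ∂P = 0)
    (hE : IsDependencyGraph E ξ P) (hm0 : 0 < m) (hm : ∀ k, ((nbhd E k).card : ℝ) ≤ m)
    (hθ : 0 < θ) (hK : 0 ≤ K) (hf : ∀ x, HasDerivAt f (f' x) x) (hf' : Continuous f')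
    {b b' : ℝ} (hb : ∀ x, |f x| ≤ b) (hb' : ∀ x, |f' x| ≤ b')
    (hH : ∀ x y, |f' x - f' y| ≤ K * |x - y| ^ θ) (k : V) :
    |∫ ω, ξ k ω * f (∑ i, ξ i ω) ∂P
        - ∑ j ∈ nbhd E k, ∫ ω, ξ k ω * ξ j ω * f' (∑ i, ξ i ω) ∂P| ≤
      K * (m ^ (1 + θ) * ((∫ ω, |ξ k ω| ^ (2 + θ) ∂P
        + (1 + θ) * (m⁻¹ * ∑ i ∈ nbhd E k, ∫ ω, |ξ i ω| ^ (2 + θ) ∂P)) / (2 + θ))) := by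
  have hfc : Continuous f := continuous_iff_continuousAt.2 fun x => (hf x).continuousAt
  have hp := fun k => integrable_rpow_abs_of_memLp hθ (hξ k)
  have h2 := fun k => memLp_two_of_memLp hθ (hξ k)
  have h1 : ∀ k, Integrable (ξ k) P := fun k => (h2 k).integrable one_le_two
  have hmul : ∀ k j, Integrable (fun ω => ξ k ω * ξ j ω) P := fun k j =>
    (h2 k).integrable_mul (h2 j)
  set N := nbhd E k with hN
  have hindep : ∫ ω, ξ k ω * f (∑ i ∈ Nᶜ, ξ i ω) ∂P = 0 := by
    have h := hE.indepFun_sum_compl {k} N (by simp [hN])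
    have hφ : Measurable fun v : ({k} : Finset V) → ℝ => v ⟨k, Finset.mem_singleton_self k⟩ :=
      measurable_pi_apply _
    have h' := h.comp hφ hfc.measurable
    have := h'.integral_fun_mul_eq_mul_integral
      (hξm k).aestronglyMeasurable (hfc.measurable.comp (by fun_prop)).aestronglyMeasurable
    refine this.trans ?_
    simp only [Function.comp]
    rw [h0 k, zero_mul]
  have hIf : ∀ B : Finset V, Integrable (fun ω => ξ k ω * f (∑ i ∈ B, ξ i ω)) P := fun B =>
    (h1 k).mul_bdd (c := b) (hfc.measurable.comp (by fun_prop)).aestronglyMeasurable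
      (Filter.Eventually.of_forall fun ω => hb _)
  have hIf' : ∀ j, Integrable (fun ω => ξ k ω * ξ j ω * f' (∑ i, ξ i ω)) P := fun j =>
    (hmul k j).mul_bdd (c := b') (hf'.measurable.comp (by fun_prop)).aestronglyMeasurable
      (Filter.Eventually.of_forall fun ω => hb' _)
  have hIsub : Integrable
      (fun ω => ξ k ω * f (∑ i, ξ i ω) - ξ k ω * f (∑ i ∈ Nᶜ, ξ i ω)) P := (hIf _).sub (hIf _)
  have hrw : ∫ ω, ξ k ω * f (∑ i, ξ i ω) ∂P
        - ∑ j ∈ N, ∫ ω, ξ k ω * ξ j ω * f' (∑ i, ξ i ω) ∂P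
      = ∫ ω, ξ k ω * (f (∑ i, ξ i ω) - f (∑ i ∈ Nᶜ, ξ i ω)
          - (∑ i, ξ i ω - ∑ i ∈ Nᶜ, ξ i ω) * f' (∑ i, ξ i ω)) ∂P := by
    rw [← integral_finsetSum _ fun j _ => hIf' j, ← sub_zero (∫ ω, ξ k ω * f (∑ i, ξ i ω) ∂P),
      ← hindep, ← integral_sub (hIf _) (hIf _),
      ← integral_sub hIsub (integrable_finsetSum _ fun j _ => hIf' j)]
    congr 1
    ext ω
    rw [sub_sum_compl, mul_sub, mul_sub, Finset.sum_mul, Finset.mul_sum]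
    simp only [mul_assoc]
  rw [hrw]
  have hbound : ∀ ω, ‖ξ k ω * (f (∑ i, ξ i ω) - f (∑ i ∈ Nᶜ, ξ i ω)
      - (∑ i, ξ i ω - ∑ i ∈ Nᶜ, ξ i ω) * f' (∑ i, ξ i ω))‖ ≤
      K * (m ^ (1 + θ) * ((|ξ k ω| ^ (2 + θ)
        + (1 + θ) * (m⁻¹ * ∑ i ∈ N, |ξ i ω| ^ (2 + θ))) / (2 + θ))) := by
    intro ω
    rw [Real.norm_eq_abs, abs_mul]
    have e1 := abs_sub_sub_mul_le_of_holder hθ.le hK hf hH (∑ i, ξ i ω) (∑ i ∈ Nᶜ, ξ i ω)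
    rw [sub_sum_compl] at e1 ⊢
    calc _ ≤ |ξ k ω| * (K * |∑ i ∈ N, ξ i ω| ^ (1 + θ)) := by gcongr
      _ = K * (|ξ k ω| * |∑ i ∈ N, ξ i ω| ^ (1 + θ)) := by ring
      _ ≤ _ := by
        refine mul_le_mul_of_nonneg_left ?_ hK
        exact abs_mul_rpow_abs_sum_le N (fun i => ξ i ω) k hθ hm0 (hm k)
  have hsum : Integrable (fun ω => ∑ i ∈ N, |ξ i ω| ^ (2 + θ)) P :=
    integrable_finsetSum _ fun i _ => hp i
  refine (norm_integral_le_of_norm_le ?_ (Filter.Eventually.of_forall hbound)).trans_eq ?_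
  · exact ((((hp k).add ((hsum.const_mul _).const_mul _)).div_const _).const_mul _).const_mul _
  · rw [integral_const_mul, integral_const_mul, integral_div,
      integral_add (hp k) ((hsum.const_mul _).const_mul _), integral_const_mul, integral_const_mul,
      integral_finsetSum _ fun i _ => hp i]

/-- Decoupling `ξ k * ξ j` from `f' (W)`: both are compared with the sum outside the union of the
neighbourhoods of `k` and `j`. -/
lemma abs_integral_mul_mul_sub_le [IsProbabilityMeasure P] (hξm : ∀ k, Measurable (ξ k))
    (hξ : ∀ k, MemLp (ξ k) (ENNReal.ofReal (2 + θ)) P)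
    (hE : IsDependencyGraph E ξ P) (hm0 : 0 < m) (hm : ∀ k, ((nbhd E k).card : ℝ) ≤ m)
    (hθ : 0 < θ) (hK : 0 ≤ K) (hf' : Continuous f') {b' : ℝ} (hb' : ∀ x, |f' x| ≤ b')
    (hH : ∀ x y, |f' x - f' y| ≤ K * |x - y| ^ θ) (k j : V) :
    |∫ ω, ξ k ω * ξ j ω * f' (∑ i, ξ i ω) ∂P
        - (∫ ω, ξ k ω * ξ j ω ∂P) * ∫ ω, f' (∑ i, ξ i ω) ∂P| ≤
      2 * (K * ((2 * m) ^ θ * ((∫ ω, |ξ k ω| ^ (2 + θ) ∂P + ∫ ω, |ξ j ω| ^ (2 + θ) ∂P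
        + θ * ((2 * m)⁻¹ * ∑ i ∈ nbhd E k ∪ nbhd E j, ∫ ω, |ξ i ω| ^ (2 + θ) ∂P))
          / (2 + θ)))) := by
  have hp := fun k => integrable_rpow_abs_of_memLp hθ (hξ k)
  have h2 := fun k => memLp_two_of_memLp hθ (hξ k)
  have hmul : Integrable (fun ω => ξ k ω * ξ j ω) P := (h2 k).integrable_mul (h2 j)
  set N := nbhd E k ∪ nbhd E j with hN
  have hcard : (N.card : ℝ) ≤ 2 * m := by
    have : (N.card : ℝ) ≤ (nbhd E k).card + (nbhd E j).card := by
      exact_mod_cast Finset.card_union_le _ _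
    linarith [hm k, hm j]
  have h2m : 0 < 2 * m := by positivity
  have hg : ∀ B : Finset V, AEStronglyMeasurable (fun ω => f' (∑ i ∈ B, ξ i ω)) P := fun B =>
    (hf'.measurable.comp (by fun_prop)).aestronglyMeasurable
  have hindep : ∫ ω, ξ k ω * ξ j ω * f' (∑ i ∈ Nᶜ, ξ i ω) ∂P
      = (∫ ω, ξ k ω * ξ j ω ∂P) * ∫ ω, f' (∑ i ∈ Nᶜ, ξ i ω) ∂P := by
    have h := hE.indepFun_sum_compl {k, j} N (by
      intro i hi
      rcases Finset.mem_insert.1 hi with rfl | hi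
      · exact Finset.subset_union_left
      · rw [Finset.mem_singleton.1 hi]; exact Finset.subset_union_right)
    have h' := h.comp (ψ := f')
      (φ := fun v : ({k, j} : Finset V) → ℝ => v ⟨k, by simp⟩ * v ⟨j, by simp⟩) (by fun_prop) hf'.measurable
    exact h'.integral_fun_mul_eq_mul_integral
      ((hξm k).mul (hξm j)).aestronglyMeasurable (hg _)
  have hI1 : ∀ B : Finset V, Integrable (fun ω => f' (∑ i ∈ B, ξ i ω)) P := fun B =>
    Integrable.of_bound (hg B) b' (Filter.Eventually.of_forall fun ω => hb' _)
  have hI2 : ∀ B : Finset V, Integrable (fun ω => ξ k ω * ξ j ω * f' (∑ i ∈ B, ξ i ω)) P := fun B =>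
    hmul.mul_bdd (c := b') (hg B) (Filter.Eventually.of_forall fun ω => hb' _)
  have hrw : ∫ ω, ξ k ω * ξ j ω * f' (∑ i, ξ i ω) ∂P
        - (∫ ω, ξ k ω * ξ j ω ∂P) * ∫ ω, f' (∑ i, ξ i ω) ∂P
      = ∫ ω, ξ k ω * ξ j ω * (f' (∑ i, ξ i ω) - f' (∑ i ∈ Nᶜ, ξ i ω)) ∂P
        - ∫ ω', (∫ ω, ξ k ω * ξ j ω ∂P) * (f' (∑ i, ξ i ω') - f' (∑ i ∈ Nᶜ, ξ i ω')) ∂P := by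
    simp only [mul_sub]
    rw [integral_sub (hI2 _) (hI2 _), integral_sub ((hI1 _).const_mul _) ((hI1 _).const_mul _),
      integral_const_mul, integral_const_mul, hindep]
    ring
  have hdiff : ∀ ω, |f' (∑ i, ξ i ω) - f' (∑ i ∈ Nᶜ, ξ i ω)| ≤ K * |∑ i ∈ N, ξ i ω| ^ θ := by
    intro ω
    have := hH (∑ i, ξ i ω) (∑ i ∈ Nᶜ, ξ i ω)
    rwa [sub_sum_compl] at this
  have hsum : Integrable (fun ω => ∑ i ∈ N, |ξ i ω| ^ (2 + θ)) P :=
    integrable_finsetSum _ fun i _ => hp i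
  have hkj : Integrable (fun ω => |ξ k ω| ^ (2 + θ) + |ξ j ω| ^ (2 + θ)) P := (hp k).add (hp j)
  -- `Q` is the bound, as a function of the point `ω` for `ξ k`, `ξ j` and of the point `ω'` for
  -- the sum over `N`.
  set Q : Ω → Ω → ℝ := fun ω ω' => K * ((2 * m) ^ θ * ((|ξ k ω| ^ (2 + θ) + |ξ j ω| ^ (2 + θ)
    + θ * ((2 * m)⁻¹ * ∑ i ∈ N, |ξ i ω'| ^ (2 + θ))) / (2 + θ))) with hQ
  have hQb : ∀ ω ω', |ξ k ω * ξ j ω| * |f' (∑ i, ξ i ω') - f' (∑ i ∈ Nᶜ, ξ i ω')| ≤ Q ω ω' := by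
    intro ω ω'
    calc _ ≤ |ξ k ω * ξ j ω| * (K * |∑ i ∈ N, ξ i ω'| ^ θ) := by gcongr; exact hdiff ω'
      _ = K * (|ξ k ω * ξ j ω| * |∑ i ∈ N, ξ i ω'| ^ θ) := by ring
      _ ≤ _ := by
        refine mul_le_mul_of_nonneg_left ?_ hK
        exact abs_mul_mul_rpow_abs_sum_le N (fun i => ξ i ω') _ _ hθ h2m hcard
  have hS : ∫ ω, ∑ i ∈ N, |ξ i ω| ^ (2 + θ) ∂P = ∑ i ∈ N, ∫ ω, |ξ i ω| ^ (2 + θ) ∂P :=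
    integral_finsetSum _ fun i _ => hp i
  have hA : |∫ ω, ξ k ω * ξ j ω * (f' (∑ i, ξ i ω) - f' (∑ i ∈ Nᶜ, ξ i ω)) ∂P| ≤
      K * ((2 * m) ^ θ * ((∫ ω, |ξ k ω| ^ (2 + θ) ∂P + ∫ ω, |ξ j ω| ^ (2 + θ) ∂P
        + θ * ((2 * m)⁻¹ * ∑ i ∈ N, ∫ ω, |ξ i ω| ^ (2 + θ) ∂P)) / (2 + θ))) := by
    rw [← Real.norm_eq_abs]
    refine (norm_integral_le_of_norm_le (g := fun ω => Q ω ω) ?_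
      (Filter.Eventually.of_forall fun ω => ?_)).trans_eq ?_
    · exact (((hkj.add
        ((hsum.const_mul _).const_mul _)).div_const _).const_mul _).const_mul _
    · rw [Real.norm_eq_abs, abs_mul]; exact hQb ω ω
    · simp only [hQ]
      rw [integral_const_mul, integral_const_mul, integral_div,
        integral_add hkj ((hsum.const_mul _).const_mul _),
        integral_add (hp k) (hp j), integral_const_mul, integral_const_mul, hS]
  have hB : |∫ ω', (∫ ω, ξ k ω * ξ j ω ∂P) * (f' (∑ i, ξ i ω') - f' (∑ i ∈ Nᶜ, ξ i ω')) ∂P| ≤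
      K * ((2 * m) ^ θ * ((∫ ω, |ξ k ω| ^ (2 + θ) ∂P + ∫ ω, |ξ j ω| ^ (2 + θ) ∂P
        + θ * ((2 * m)⁻¹ * ∑ i ∈ N, ∫ ω, |ξ i ω| ^ (2 + θ) ∂P)) / (2 + θ))) := by
    rw [← Real.norm_eq_abs]
    refine (norm_integral_le_of_norm_le (g := fun ω' => K * ((2 * m) ^ θ *
      ((∫ ω, |ξ k ω| ^ (2 + θ) ∂P + ∫ ω, |ξ j ω| ^ (2 + θ) ∂P
        + θ * ((2 * m)⁻¹ * ∑ i ∈ N, |ξ i ω'| ^ (2 + θ))) / (2 + θ)))) ?_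
      (Filter.Eventually.of_forall fun ω' => ?_)).trans_eq ?_
    · exact ((((integrable_const _).add
        ((hsum.const_mul _).const_mul _)).div_const _).const_mul _).const_mul _
    · rw [← integral_mul_const]
      refine (norm_integral_le_of_norm_le (g := fun ω => Q ω ω') ?_
        (Filter.Eventually.of_forall fun ω => ?_)).trans_eq ?_
      · exact (((hkj.add (integrable_const _)).div_const _).const_mul _).const_mul _
      · rw [Real.norm_eq_abs, abs_mul]; exact hQb ω ω'
      · simp only [hQ]
        rw [integral_const_mul, integral_const_mul, integral_div,
          integral_add hkj (integrable_const _), integral_add (hp k) (hp j),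
          integral_const, probReal_univ, one_smul]
    · rw [integral_const_mul, integral_const_mul, integral_div,
        integral_add (integrable_const _) ((hsum.const_mul _).const_mul _),
        integral_const_mul, integral_const_mul, hS, integral_const, probReal_univ, one_smul]
  rw [hrw]
  calc _ ≤ _ := abs_sub _ _
    _ ≤ _ := add_le_add hA hB
    _ = _ := by ring

/-- The covariances within neighbourhoods add up to the variance. -/
lemma sum_integral_mul_nbhd (hξm : ∀ k, Measurable (ξ k)) (h2 : ∀ k, MemLp (ξ k) 2 P)
    (h0 : ∀ k, ∫ ω, ξ k ω ∂P = 0) (hE : IsDependencyGraph E ξ P) :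
    ∑ k, ∑ j ∈ nbhd E k, ∫ ω, ξ k ω * ξ j ω ∂P = ∫ ω, (∑ k, ξ k ω) ^ 2 ∂P := by
  have hmul : ∀ k j, Integrable (fun ω => ξ k ω * ξ j ω) P := fun k j =>
    (h2 k).integrable_mul (h2 j)
  have hindep : ∀ k, ∑ j ∈ (nbhd E k)ᶜ, ∫ ω, ξ k ω * ξ j ω ∂P = 0 := by
    intro k
    have h := hE.indepFun_sum_compl {k} (nbhd E k) (by simp)
    have hφ : Measurable fun v : ({k} : Finset V) → ℝ => v ⟨k, Finset.mem_singleton_self k⟩ :=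
      measurable_pi_apply _
    have h' := h.comp hφ measurable_id
    have := h'.integral_fun_mul_eq_mul_integral
      (hξm k).aestronglyMeasurable
      (measurable_id.comp (by fun_prop)).aestronglyMeasurable
    rw [← integral_finsetSum _ fun j _ => hmul k j]
    simp only [← Finset.mul_sum]
    refine this.trans ?_
    simp only [Function.comp]
    rw [h0 k, zero_mul]
  have h1 : ∀ k, ∑ j ∈ nbhd E k, ∫ ω, ξ k ω * ξ j ω ∂P = ∑ j, ∫ ω, ξ k ω * ξ j ω ∂P := by
    intro k
    rw [← Finset.sum_add_sum_compl (nbhd E k), hindep k, add_zero]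
  simp only [h1]
  have h3 : ∀ ω, (∑ k, ξ k ω) ^ 2 = ∑ k, ∑ j, ξ k ω * ξ j ω := fun ω => by
    rw [sq, Finset.sum_mul_sum]
  simp only [h3]
  rw [integral_finsetSum _ fun k _ => integrable_finsetSum _ fun j _ => hmul k j]
  exact Finset.sum_congr rfl fun k _ => (integral_finsetSum _ fun j _ => hmul k j).symm

/-- **Stein's bound for a dependency graph**: for centred variables with a sum `W` of variance one,
the Stein operator of a function with `θ`-Hölder derivative has expectation at most
`5 K m ^ (1 + θ) ∑ k, 𝔼 |ξ k| ^ (2 + θ)`, where `m` bounds the size of the neighbourhoods. -/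
theorem abs_integral_steinOperator_le [IsProbabilityMeasure P] (hξm : ∀ k, Measurable (ξ k))
    (hξ : ∀ k, MemLp (ξ k) (ENNReal.ofReal (2 + θ)) P) (h0 : ∀ k, ∫ ω, ξ k ω ∂P = 0)
    (hvar : ∫ ω, (∑ k, ξ k ω) ^ 2 ∂P = 1)
    (hE : IsDependencyGraph E ξ P) (hm0 : 0 < m) (hm : ∀ k, ((nbhd E k).card : ℝ) ≤ m)
    (hθ : 0 < θ) (hθ1 : θ ≤ 1) (hK : 0 ≤ K) (hf : ∀ x, HasDerivAt f (f' x) x)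
    (hf' : Continuous f') {b b' : ℝ} (hb : ∀ x, |f x| ≤ b) (hb' : ∀ x, |f' x| ≤ b')
    (hH : ∀ x y, |f' x - f' y| ≤ K * |x - y| ^ θ) :
    |∫ ω, (f' (∑ k, ξ k ω) - (∑ k, ξ k ω) * f (∑ k, ξ k ω)) ∂P| ≤
      5 * K * m ^ (1 + θ) * ∑ k, ∫ ω, |ξ k ω| ^ (2 + θ) ∂P := by
  have hfc : Continuous f := continuous_iff_continuousAt.2 fun x => (hf x).continuousAt
  have h2 := fun k => memLp_two_of_memLp hθ (hξ k)
  have h1 : ∀ k, Integrable (ξ k) P := fun k => (h2 k).integrable one_le_two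
  have hIf : ∀ k, Integrable (fun ω => ξ k ω * f (∑ i, ξ i ω)) P := fun k =>
    (h1 k).mul_bdd (c := b) (hfc.measurable.comp (by fun_prop)).aestronglyMeasurable
      (Filter.Eventually.of_forall fun ω => hb _)
  have hIf' : Integrable (fun ω => f' (∑ i, ξ i ω)) P :=
    Integrable.of_bound (hf'.measurable.comp (by fun_prop)).aestronglyMeasurable b'
      (Filter.Eventually.of_forall fun ω => hb' _)
  set β : V → ℝ := fun k => ∫ ω, |ξ k ω| ^ (2 + θ) ∂P with hβ
  have hβ0 : ∀ k, 0 ≤ β k := fun k => integral_nonneg fun ω => by positivity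
  have hB0 : 0 ≤ ∑ k, β k := Finset.sum_nonneg fun k _ => hβ0 k
  set F := ∫ ω, f' (∑ i, ξ i ω) ∂P with hF
  have hone := sum_integral_mul_nbhd hξm h2 h0 hE
  rw [hvar] at hone
  have hrw : ∫ ω, (f' (∑ k, ξ k ω) - (∑ k, ξ k ω) * f (∑ k, ξ k ω)) ∂P
      = -(∑ k, (∫ ω, ξ k ω * f (∑ i, ξ i ω) ∂P
          - ∑ j ∈ nbhd E k, ∫ ω, ξ k ω * ξ j ω * f' (∑ i, ξ i ω) ∂P)
        + ∑ k, ∑ j ∈ nbhd E k, (∫ ω, ξ k ω * ξ j ω * f' (∑ i, ξ i ω) ∂P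
          - (∫ ω, ξ k ω * ξ j ω ∂P) * F)) := by
    simp only [Finset.sum_sub_distrib, ← Finset.sum_mul]
    rw [hone]
    simp only [Finset.sum_mul]
    rw [integral_sub hIf' (integrable_finsetSum _ fun k _ => hIf k),
      integral_finsetSum _ fun k _ => hIf k]
    ring
  have hR : |∑ k, (∫ ω, ξ k ω * f (∑ i, ξ i ω) ∂P
      - ∑ j ∈ nbhd E k, ∫ ω, ξ k ω * ξ j ω * f' (∑ i, ξ i ω) ∂P)|
      ≤ K * m ^ (1 + θ) * ∑ k, β k := by
    calc _ ≤ ∑ k, _ := Finset.abs_sum_le_sum_abs _ _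
      _ ≤ ∑ k, K * (m ^ (1 + θ) * ((β k + (1 + θ) * (m⁻¹ * ∑ i ∈ nbhd E k, β i)) / (2 + θ))) :=
        Finset.sum_le_sum fun k _ =>
          abs_integral_mul_sub_le hξm hξ h0 hE hm0 hm hθ hK hf hf' hb hb' hH k
      _ = K * m ^ (1 + θ) * ((∑ k, β k
            + (1 + θ) * (m⁻¹ * ∑ k, ∑ i ∈ nbhd E k, β i)) / (2 + θ)) := by
        rw [Finset.mul_sum (s := Finset.univ) (a := m⁻¹), Finset.mul_sum (a := 1 + θ),
          ← Finset.sum_add_distrib, Finset.sum_div, Finset.mul_sum]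
        exact Finset.sum_congr rfl fun k _ => by ring
      _ ≤ K * m ^ (1 + θ) * ((∑ k, β k + (1 + θ) * (m⁻¹ * (m * ∑ k, β k))) / (2 + θ)) := by
        gcongr
        exact sum_sum_nbhd_right_le hm hβ0
      _ = K * m ^ (1 + θ) * ∑ k, β k := by field_simp; ring
  have hQ : |∑ k, ∑ j ∈ nbhd E k, (∫ ω, ξ k ω * ξ j ω * f' (∑ i, ξ i ω) ∂P
          - (∫ ω, ξ k ω * ξ j ω ∂P) * F)| ≤ 2 * K * ((2 * m) ^ θ * m) * ∑ k, β k := by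
    calc _ ≤ ∑ k, ∑ j ∈ nbhd E k, |_| := (Finset.abs_sum_le_sum_abs _ _).trans
          (Finset.sum_le_sum fun k _ => Finset.abs_sum_le_sum_abs _ _)
      _ ≤ ∑ k, ∑ j ∈ nbhd E k, 2 * (K * ((2 * m) ^ θ * ((β k + β j
            + θ * ((2 * m)⁻¹ * ∑ i ∈ nbhd E k ∪ nbhd E j, β i)) / (2 + θ)))) :=
        Finset.sum_le_sum fun k _ => Finset.sum_le_sum fun j _ =>
          abs_integral_mul_mul_sub_le hξm hξ hE hm0 hm hθ hK hf' hb' hH k j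
      _ = 2 * K * (2 * m) ^ θ * ((∑ k, ∑ _j ∈ nbhd E k, β k + ∑ k, ∑ j ∈ nbhd E k, β j
            + θ * ((2 * m)⁻¹ * ∑ k, ∑ j ∈ nbhd E k, ∑ i ∈ nbhd E k ∪ nbhd E j, β i))
              / (2 + θ)) := by
        simp only [Finset.mul_sum (a := (2 * m)⁻¹), Finset.mul_sum (a := θ),
          ← Finset.sum_add_distrib, Finset.sum_div]
        simp only [Finset.mul_sum (a := 2 * K * (2 * m) ^ θ)]
        refine Finset.sum_congr rfl fun k _ => Finset.sum_congr rfl fun j _ => ?_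
        simp only [← Finset.mul_sum]
        ring
      _ ≤ 2 * K * (2 * m) ^ θ * ((m * ∑ k, β k + m * ∑ k, β k
            + θ * ((2 * m)⁻¹ * (2 * m ^ 2 * ∑ k, β k))) / (2 + θ)) := by
        gcongr
        · exact sum_sum_nbhd_left_le hm hβ0
        · exact sum_sum_nbhd_right_le hm hβ0
        · exact sum_sum_nbhd_union_le hm hβ0
      _ = _ := by field_simp; ring
  have hpow : (2 * m) ^ θ * m ≤ 2 * m ^ (1 + θ) := by
    rw [Real.mul_rpow zero_le_two hm0.le, add_comm 1 θ, Real.rpow_add_one hm0.ne']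
    have : (2 : ℝ) ^ θ ≤ 2 := by
      simpa using Real.rpow_le_rpow_of_exponent_le one_le_two hθ1
    calc (2 : ℝ) ^ θ * m ^ θ * m ≤ 2 * m ^ θ * m := by gcongr
      _ = _ := by ring
  rw [hrw, abs_neg]
  calc _ ≤ _ := abs_add_le _ _
    _ ≤ K * m ^ (1 + θ) * ∑ k, β k + 2 * K * ((2 * m) ^ θ * m) * ∑ k, β k := add_le_add hR hQ
    _ ≤ K * m ^ (1 + θ) * ∑ k, β k + 2 * K * (2 * m ^ (1 + θ)) * ∑ k, β k := by gcongr
    _ = _ := by ring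

end Stein

/-! ### Kolmogorov distance for a dependency graph -/

lemma kolmogorovDist_le_one (μ ν : Measure ℝ) [IsProbabilityMeasure μ] [IsProbabilityMeasure ν] :
    kolmogorovDist μ ν ≤ 1 := by
  refine ciSup_le fun t => abs_le.2 ⟨?_, ?_⟩ <;>
    linarith [measureReal_nonneg (μ := μ) (s := Set.Iic t), measureReal_le_one (μ := μ)
      (s := Set.Iic t), measureReal_nonneg (μ := ν) (s := Set.Iic t), measureReal_le_one (μ := ν)
      (s := Set.Iic t)]

/-- Interpolation between a bound on the oscillation and a Lipschitz bound. -/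
lemma abs_sub_le_rpow_of_lipschitz {g : ℝ → ℝ} {c b θ : ℝ} (hc : 0 ≤ c) (hb : 0 ≤ b) (hθ : 0 ≤ θ)
    (hθ1 : θ ≤ 1) (hg : ∀ x, |g x| ≤ c / 2) (hL : ∀ x y, |g x - g y| ≤ c * b * |x - y|)
    (x y : ℝ) : |g x - g y| ≤ c * b ^ θ * |x - y| ^ θ := by
  have h1 : |g x - g y| ≤ c := (abs_sub _ _).trans (by linarith [hg x, hg y])
  calc |g x - g y| = |g x - g y| ^ (1 - θ) * |g x - g y| ^ θ := by
        rw [← Real.rpow_add_of_nonneg (abs_nonneg _) (by linarith) hθ, sub_add_cancel,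
          Real.rpow_one]
    _ ≤ c ^ (1 - θ) * (c * b * |x - y|) ^ θ :=
        mul_le_mul (Real.rpow_le_rpow (abs_nonneg _) h1 (by linarith))
          (Real.rpow_le_rpow (abs_nonneg _) (hL x y) hθ) (by positivity) (by positivity)
    _ = c ^ (1 - θ) * c ^ θ * b ^ θ * |x - y| ^ θ := by
        rw [Real.mul_rpow (by positivity) (abs_nonneg _), Real.mul_rpow hc hb]; ring
    _ = c * b ^ θ * |x - y| ^ θ := by
        rw [← Real.rpow_add_of_nonneg hc (by linarith) hθ, sub_add_cancel, Real.rpow_one]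

/-- Stein's bound for smoothed indicators, with a free smoothing scale `a`. -/
theorem kolmogorovDist_map_sum_le {V Ω : Type*} [Fintype V] [MeasurableSpace Ω] {P : Measure Ω}
    [IsProbabilityMeasure P] {ξ : V → Ω → ℝ} {E : Multiset (Sym2 V)} {m θ a : ℝ}
    (hξm : ∀ k, Measurable (ξ k)) (hξ : ∀ k, MemLp (ξ k) (ENNReal.ofReal (2 + θ)) P)
    (h0 : ∀ k, ∫ ω, ξ k ω ∂P = 0) (hvar : ∫ ω, (∑ k, ξ k ω) ^ 2 ∂P = 1)
    (hE : IsDependencyGraph E ξ P) (hm0 : 0 < m) (hm : ∀ k, ((nbhd E k).card : ℝ) ≤ m)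
    (hθ : 0 < θ) (hθ1 : θ ≤ 1) (ha : 0 < a) :
    kolmogorovDist (P.map fun ω => ∑ k, ξ k ω) (gaussianReal 0 1) ≤
      2 * a + 30 * (1 + 1 / (2 * a)) ^ θ * m ^ (1 + θ) * ∑ k, ∫ ω, |ξ k ω| ^ (2 + θ) ∂P := by
  have hWm : Measurable fun ω => ∑ k, ξ k ω := by fun_prop
  have := Measure.isProbabilityMeasure_map (μ := P) hWm.aemeasurable
  refine kolmogorovDist_gaussianReal_le _ ha fun h h' hd h01 hb => ?_
  obtain ⟨f, f', hf, hstein, hf0, hf1, hfc, hf2⟩ := exists_steinSolution_of_hasDerivAt hd h01 hb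
  have hc : Continuous h := continuous_iff_continuousAt.2 fun x => (hd x).continuousAt
  have hb0 : 0 ≤ 1 + 1 / (2 * a) := by positivity
  have hH := abs_sub_le_rpow_of_lipschitz (g := f') (c := 6) (b := 1 + 1 / (2 * a)) (by norm_num)
    hb0 hθ.le hθ1 (fun x => (hf1 x).trans (by norm_num)) (fun x y => (hf2 x y).trans_eq (by
      field_simp; ring))
  have hkey := abs_integral_steinOperator_le hξm hξ h0 hvar hE hm0 hm hθ hθ1 (by positivity) hf hfc
    hf0 hf1 hH
  have hint : Integrable (fun ω => h (∑ k, ξ k ω)) P :=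
    Integrable.of_bound (hc.measurable.comp hWm).aestronglyMeasurable 1
      (Filter.Eventually.of_forall fun ω => by
        rw [Real.norm_eq_abs, abs_of_nonneg (h01 _).1]; exact (h01 _).2)
  rw [integral_map hWm.aemeasurable hc.aestronglyMeasurable]
  simp only [hstein] at hkey
  rw [integral_sub hint (integrable_const _), integral_const, probReal_univ, one_smul] at hkey
  refine hkey.trans_eq ?_
  ring

/-! ### Moments and normalization -/

section Moments

variable {Ω : Type*} [MeasurableSpace Ω] {P : Measure Ω} [IsProbabilityMeasure P]

/-- Centring at the mean instead of at an arbitrary constant costs at most a factor `2 ^ p`. -/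
lemma integral_abs_sub_integral_rpow_le {X : Ω → ℝ} {p : ℝ} (hp : 1 ≤ p) (c : ℝ)
    (hX : Integrable X P) (hp' : Integrable (fun ω => |X ω - c| ^ p) P) :
    ∫ ω, |X ω - ∫ ω', X ω' ∂P| ^ p ∂P ≤ 2 ^ p * ∫ ω, |X ω - c| ^ p ∂P := by
  have hXc : Integrable (fun ω => X ω - c) P := hX.sub (integrable_const c)
  have hmean : ∫ ω, (X ω - c) ∂P = ∫ ω, X ω ∂P - c := by
    rw [integral_sub hX (integrable_const c)]; simp
  have hjensen : |∫ ω, X ω ∂P - c| ^ p ≤ ∫ ω, |X ω - c| ^ p ∂P := by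
    rw [← hmean]
    calc |∫ ω, (X ω - c) ∂P| ^ p ≤ (∫ ω, |X ω - c| ∂P) ^ p :=
          Real.rpow_le_rpow (abs_nonneg _) abs_integral_le_integral_abs (by linarith)
      _ ≤ ∫ ω, |X ω - c| ^ p ∂P :=
          (convexOn_rpow hp).map_integral_le
            (Real.continuous_rpow_const (by linarith)).continuousOn isClosed_Ici
            (Filter.Eventually.of_forall fun ω => Set.mem_Ici.2 (abs_nonneg _)) hXc.abs hp'
  have hpt : ∀ ω, |X ω - ∫ ω', X ω' ∂P| ^ p ≤
      2 ^ p * (2⁻¹ * (|X ω - c| ^ p + |∫ ω, X ω ∂P - c| ^ p)) := by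
    intro ω
    have h := rpow_abs_sum_div_le Finset.univ ![X ω - c, -(∫ ω, X ω ∂P - c)] hp two_pos (by simp)
    simp only [Fin.sum_univ_two, Matrix.cons_val_zero, Matrix.cons_val_one, abs_neg] at h
    rw [Real.div_rpow (abs_nonneg _) zero_le_two, div_le_iff₀' (by positivity)] at h
    have e : X ω - c + -(∫ ω, X ω ∂P - c) = X ω - ∫ ω', X ω' ∂P := by ring
    rwa [e] at h
  calc ∫ ω, |X ω - ∫ ω', X ω' ∂P| ^ p ∂P
      ≤ ∫ ω, 2 ^ p * (2⁻¹ * (|X ω - c| ^ p + |∫ ω, X ω ∂P - c| ^ p)) ∂P :=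
        integral_mono_of_nonneg (Filter.Eventually.of_forall fun ω => by positivity)
          (((hp'.add (integrable_const _)).const_mul _).const_mul _)
          (Filter.Eventually.of_forall hpt)
    _ = 2 ^ p * (2⁻¹ * (∫ ω, |X ω - c| ^ p ∂P + |∫ ω, X ω ∂P - c| ^ p)) := by
        rw [integral_const_mul, integral_const_mul, integral_add hp' (integrable_const _),
          integral_const, probReal_univ, one_smul]
    _ ≤ 2 ^ p * (2⁻¹ * (∫ ω, |X ω - c| ^ p ∂P + ∫ ω, |X ω - c| ^ p ∂P)) := by gcongr
    _ = 2 ^ p * ∫ ω, |X ω - c| ^ p ∂P := by ring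

lemma memLp_of_lintegral_abs_sub_rpow_lt_top {X : Ω → ℝ} (hX : Measurable X) {p c : ℝ}
    (hp : 0 < p) (h : ∫⁻ ω, ENNReal.ofReal (|X ω - c| ^ p) ∂P < ∞) :
    MemLp X (ENNReal.ofReal p) P ∧ Integrable (fun ω => |X ω - c| ^ p) P := by
  have hm : Measurable fun ω => X ω - c := hX.sub_const c
  have h1 : Integrable (fun ω => |X ω - c| ^ p) P :=
    ⟨(hm.abs.pow_const p).aestronglyMeasurable,
      (hasFiniteIntegral_iff_ofReal (Filter.Eventually.of_forall fun ω => by positivity)).2 h⟩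
  refine ⟨?_, h1⟩
  have h2 : MemLp (fun ω => X ω - c) (ENNReal.ofReal p) P := by
    rw [← integrable_norm_rpow_iff hm.aestronglyMeasurable (by simpa using hp)
      ENNReal.ofReal_ne_top, ENNReal.toReal_ofReal hp.le]
    exact h1
  have e : X = (fun ω => X ω - c) + fun _ => c := by ext ω; simp
  rw [e]
  exact h2.add (memLp_const c)

end Moments

lemma IsDependencyGraph.comp {V Ω : Type*} [MeasurableSpace Ω] {P : Measure Ω}
    {E : Multiset (Sym2 V)} {Y : V → Ω → ℝ} (hE : IsDependencyGraph E Y P) {g : V → ℝ → ℝ}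
    (hg : ∀ k, Measurable (g k)) : IsDependencyGraph E (fun k ω => g k (Y k ω)) P := by
  intro V₁ V₂ hd he
  have hm : ∀ A : Finset V, Measurable fun (v : A → ℝ) (i : A) => g i (v i) := fun A =>
    measurable_pi_lambda _ fun i => (hg i).comp (measurable_pi_apply i)
  exact (hE V₁ V₂ hd he).comp (hm V₁) (hm V₂)

/-- The bound, written in terms of `ξ_δ`, `N` and `D + 1`, depends only on the Lyapunov ratio
`(D + 1) ^ (δ - 1) A_δ / v ^ δ`. -/
lemma renormStdDev_rpow_mul_rpow {N M m s δ : ℝ} (hN : 0 < N) (hM : 0 < M) (hm : 0 < m)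
    (hs : 0 < s) (hδ : 0 < δ) :
    ((N / M) ^ (1 / δ) * √(s / (N * m))) ^ (-(δ / (δ + 1))) *
      (m / N) ^ ((δ - 2) / (2 * (δ + 1))) = (m ^ (δ - 1) * (M / √s ^ δ)) ^ (1 / (δ + 1)) := by
  have hsq : 0 < √s := Real.sqrt_pos.2 hs
  apply Real.log_injOn_pos (Set.mem_Ioi.2 (by positivity)) (Set.mem_Ioi.2 (by positivity))
  rw [Real.log_mul (by positivity) (by positivity), Real.log_rpow (by positivity),
    Real.log_rpow (by positivity), Real.log_rpow (by positivity),
    Real.log_mul (by positivity) (by positivity), Real.log_mul (by positivity) (by positivity),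
    Real.log_rpow (by positivity), Real.log_rpow (by positivity), Real.log_sqrt (by positivity),
    Real.log_div (by positivity) (by positivity), Real.log_div (by positivity) (by positivity),
    Real.log_div (by positivity) (by positivity), Real.log_div (by positivity) (by positivity),
    Real.log_mul (by positivity) (by positivity), Real.log_rpow (by positivity),
    Real.log_sqrt (by positivity)]
  have : δ + 1 ≠ 0 := by positivity
  field_simp
  ring

/-- The choice `a = x` of the smoothing scale, where `x ^ (δ + 1)` is the Lyapunov ratio. -/
lemma smoothing_bound_le {x θ : ℝ} (hx : 0 < x) (hx1 : x < 1 / 8) (hθ : 0 < θ) (hθ1 : θ ≤ 1) :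
    2 * x + 30 * (1 + 1 / (2 * x)) ^ θ * (2 ^ (2 + θ) * x ^ (3 + θ)) ≤ 8.015 * x := by
  have h2 : (2 : ℝ) ^ (2 + θ) ≤ 8 := by
    calc (2 : ℝ) ^ (2 + θ) ≤ 2 ^ (3 : ℝ) :=
          Real.rpow_le_rpow_of_exponent_le one_le_two (by linarith)
      _ = 8 := by norm_num
  have h3 : (1 + 1 / (2 * x)) ^ θ * x ^ θ ≤ 1 := by
    rw [← Real.mul_rpow (by positivity) hx.le]
    apply Real.rpow_le_one (by positivity) _ hθ.le
    have : (1 + 1 / (2 * x)) * x = x + 1 / 2 := by field_simp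
    linarith
  have h4 : x ^ (3 + θ) = x ^ 3 * x ^ θ := by
    rw [Real.rpow_add hx]; norm_cast
  have h5 : x ^ 3 ≤ x * (1 / 64) := by nlinarith [sq_nonneg x]
  calc 2 * x + 30 * (1 + 1 / (2 * x)) ^ θ * (2 ^ (2 + θ) * x ^ (3 + θ))
      = 2 * x + 30 * 2 ^ (2 + θ) * x ^ 3 * ((1 + 1 / (2 * x)) ^ θ * x ^ θ) := by rw [h4]; ring
    _ ≤ 2 * x + 30 * 8 * (x * (1 / 64)) * 1 := by gcongr
    _ ≤ 8.015 * x := by linarith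

end DependencyGraphCLT

theorem mainTheorem3 {V Ω : Type*} [Fintype V] [MeasurableSpace Ω]
    (P : Measure Ω) [IsProbabilityMeasure P]
    (Y : V → Ω → ℝ) (hY : ∀ k, Measurable (Y k))
    (E : Multiset (Sym2 V)) (hE : DependencyGraphCLT.IsDependencyGraph E Y P)
    (D : ℕ) (hD : DependencyGraphCLT.maxDegree E = D)
    (c : V → ℝ) (hv : 0 < DependencyGraphCLT.stdDev Y P)
    (δ : ℝ) (hδ : δ ∈ Set.Ioo (2 : ℝ) 3)
    (hA : DependencyGraphCLT.absMoment Y c δ P < ∞) :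
    DependencyGraphCLT.kolmogorovDist
        (P.map (DependencyGraphCLT.normalizedSum Y P)) (gaussianReal 0 1) ≤
      8.015 * DependencyGraphCLT.renormStdDev Y c D δ P ^ (-(δ / (δ + 1))) *
        (((D : ℝ) + 1) / (Fintype.card V : ℝ)) ^ ((δ - 2) / (2 * (δ + 1))) := by
  open DependencyGraphCLT in
  obtain ⟨hδ2, hδ3⟩ := hδ
  have hδ0 : 0 < δ := by linarith
  obtain ⟨θ, rfl⟩ : ∃ θ, δ = 2 + θ := ⟨δ - 2, by ring⟩
  have hθ : 0 < θ := by linarith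
  have hθ1 : θ ≤ 1 := by linarith
  have hA' : ∀ k, ∫⁻ ω, ENNReal.ofReal (|Y k ω - c k| ^ (2 + θ)) ∂P < ∞ := fun k =>
    (ENNReal.sum_lt_top.1 hA) k (Finset.mem_univ k)
  have hYL := fun k => (memLp_of_lintegral_abs_sub_rpow_lt_top (hY k) hδ0 (hA' k)).1
  have hYc := fun k => (memLp_of_lintegral_abs_sub_rpow_lt_top (hY k) hδ0 (hA' k)).2
  have hYi : ∀ k, Integrable (Y k) P := fun k =>
    (memLp_two_of_memLp hθ (hYL k)).integrable one_le_two
  have hM : (absMoment Y c (2 + θ) P).toReal = ∑ k, ∫ ω, |Y k ω - c k| ^ (2 + θ) ∂P := by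
    rw [absMoment, ENNReal.toReal_sum fun k _ => (hA' k).ne]
    refine Finset.sum_congr rfl fun k _ => ?_
    rw [integral_eq_lintegral_of_nonneg_ae (Filter.Eventually.of_forall fun ω => by positivity)
      (hYc k).aestronglyMeasurable]
  set M := (absMoment Y c (2 + θ) P).toReal with hMdef
  have hSm : Measurable (sumRV Y) := by unfold sumRV; fun_prop
  set σ := √(variance (sumRV Y) P) with hσ
  have hσ0 : 0 < σ := hv
  have hvar0 : 0 < variance (sumRV Y) P := Real.sqrt_pos.1 hσ0
  set ξ : V → Ω → ℝ := fun k ω => (Y k ω - ∫ ω', Y k ω' ∂P) / σ with hξdef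
  have hξm : ∀ k, Measurable (ξ k) := fun k => ((hY k).sub_const _).div_const _
  have hξL : ∀ k, MemLp (ξ k) (ENNReal.ofReal (2 + θ)) P := fun k => by
    have := ((hYL k).sub (memLp_const (∫ ω', Y k ω' ∂P))).mul_const σ⁻¹
    simpa only [hξdef, div_eq_mul_inv, Pi.sub_apply] using this
  have hξ0 : ∀ k, ∫ ω, ξ k ω ∂P = 0 := fun k => by
    simp only [hξdef]
    rw [integral_div, integral_sub (hYi k) (integrable_const _)]
    simp
  have hW : normalizedSum Y P = fun ω => ∑ k, ξ k ω := by
    ext ω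
    simp only [normalizedSum, hξdef]
    rw [← Finset.sum_div, Finset.sum_sub_distrib]
    simp only [sumRV]
    rw [integral_finsetSum _ fun k _ => hYi k]
  have hvar : ∫ ω, (∑ k, ξ k ω) ^ 2 ∂P = 1 := by
    have h1 : ∀ ω, (∑ k, ξ k ω) ^ 2 = (sumRV Y ω - ∫ ω', sumRV Y ω' ∂P) ^ 2 / σ ^ 2 := fun ω => by
      rw [← congrFun hW ω, normalizedSum, div_pow]
    simp only [h1]
    rw [integral_div, ← variance_eq_integral hSm.aemeasurable, hσ, Real.sq_sqrt hvar0.le,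
      div_self hvar0.ne']
  have hEξ : IsDependencyGraph E ξ P :=
    hE.comp (g := fun k y => (y - ∫ ω', Y k ω' ∂P) / σ)
      fun k => (measurable_id.sub_const _).div_const _
  have hm0 : (0 : ℝ) < (D : ℝ) + 1 := by positivity
  have hm : ∀ k, ((nbhd E k).card : ℝ) ≤ (D : ℝ) + 1 := fun k => by
    rw [← hD]; exact_mod_cast card_nbhd_le E k
  have hβ : ∑ k, ∫ ω, |ξ k ω| ^ (2 + θ) ∂P ≤ 2 ^ (2 + θ) * (M / σ ^ (2 + θ)) := by
    rw [hM, Finset.sum_div, Finset.mul_sum]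
    refine Finset.sum_le_sum fun k _ => ?_
    have h1 : ∀ ω, |ξ k ω| ^ (2 + θ) = |Y k ω - ∫ ω', Y k ω' ∂P| ^ (2 + θ) / σ ^ (2 + θ) :=
      fun ω => by
        rw [abs_div, abs_of_pos hσ0, Real.div_rpow (abs_nonneg _) hσ0.le]
    simp only [h1]
    rw [integral_div, ← mul_div_assoc]
    gcongr
    exact integral_abs_sub_integral_rpow_le (by linarith) (c k) (hYi k) (hYc k)
  -- A vanishing moment would make `W` vanish almost surely, against `𝔼 W ^ 2 = 1`.
  have hM0 : 0 < M := by
    refine lt_of_le_of_ne ENNReal.toReal_nonneg fun hM0 => ?_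
    have h1 : ∀ k, 0 ≤ ∫ ω, |ξ k ω| ^ (2 + θ) ∂P := fun k =>
      integral_nonneg fun ω => by positivity
    have h2 : ∑ k, ∫ ω, |ξ k ω| ^ (2 + θ) ∂P = 0 := by
      refine le_antisymm (hβ.trans_eq ?_) (Finset.sum_nonneg fun k _ => h1 k)
      rw [← hM0]; simp
    have h3 : ∀ᵐ ω ∂P, ∀ k, ξ k ω = 0 := by
      rw [ae_all_iff]
      intro k
      have h4 := (Finset.sum_eq_zero_iff_of_nonneg fun k _ => h1 k).1 h2 k (Finset.mem_univ k)
      rw [integral_eq_zero_iff_of_nonneg (fun ω => by positivity)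
        (integrable_rpow_abs_of_memLp hθ (hξL k))] at h4
      filter_upwards [h4] with ω hω
      simpa [Real.rpow_eq_zero (abs_nonneg _) hδ0.ne'] using hω
    have h5 : ∫ ω, (∑ k, ξ k ω) ^ 2 ∂P = 0 :=
      integral_eq_zero_of_ae (by filter_upwards [h3] with ω hω; simp [hω])
    rw [hvar] at h5
    exact one_ne_zero h5
  have hN0 : (0 : ℝ) < Fintype.card V := by
    have : Nonempty V := by
      by_contra hV
      rw [not_nonempty_iff] at hV
      rw [hM] at hM0
      simp at hM0
    exact_mod_cast Fintype.card_pos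
  set L := ((D : ℝ) + 1) ^ (2 + θ - 1) * (M / σ ^ (2 + θ)) with hL
  have hL0 : 0 < L := by positivity
  have hrhs : 8.015 * renormStdDev Y c D (2 + θ) P ^ (-((2 + θ) / (2 + θ + 1))) *
      (((D : ℝ) + 1) / (Fintype.card V : ℝ)) ^ ((2 + θ - 2) / (2 * (2 + θ + 1)))
      = 8.015 * L ^ (1 / (2 + θ + 1)) := by
    rw [mul_assoc, renormStdDev, ← hMdef, renormStdDev_rpow_mul_rpow hN0 hM0 hm0 hvar0 hδ0]
  rw [hrhs]
  set x := L ^ (1 / (2 + θ + 1)) with hx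
  have hx0 : 0 < x := by positivity
  have hxL : x ^ (3 + θ) = L := by
    rw [hx, ← Real.rpow_mul hL0.le]
    have : 1 / (2 + θ + 1) * (3 + θ) = 1 := by field_simp; ring
    rw [this, Real.rpow_one]
  have hWm : Measurable (normalizedSum Y P) := by
    rw [hW]; fun_prop
  have := Measure.isProbabilityMeasure_map (μ := P) hWm.aemeasurable
  by_cases hx8 : x < 1 / 8
  · rw [hW]
    refine (kolmogorovDist_map_sum_le hξm hξL hξ0 hvar hEξ hm0 hm hθ hθ1 hx0).trans ?_
    refine le_trans ?_ (smoothing_bound_le hx0 hx8 hθ hθ1)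
    rw [hxL, hL]
    have he : (2 + θ - 1) = 1 + θ := by ring
    rw [he]
    calc 2 * x + 30 * (1 + 1 / (2 * x)) ^ θ * ((D : ℝ) + 1) ^ (1 + θ)
          * ∑ k, ∫ ω, |ξ k ω| ^ (2 + θ) ∂P
        ≤ 2 * x + 30 * (1 + 1 / (2 * x)) ^ θ * ((D : ℝ) + 1) ^ (1 + θ)
          * (2 ^ (2 + θ) * (M / σ ^ (2 + θ))) := by gcongr
      _ = _ := by ring
  -- For large `x` the bound is trivial.
  · refine (kolmogorovDist_le_one _ _).trans ?_
    linarith [not_lt.1 hx8]
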